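/- Let $I_1,I_2$ be independent random variables, $I_i$ having the mixture Exponential-Generalized Gamma density $$f_i(x)=\frac{\omega_i}{\lambda_i}e^{-x/\lambda_i}+(1-\omega_i)\frac{c_i x^{a_ic_i-1}}{b_i^{a_ic_i}\Gamma(a_i)}e^{-(x/b_i)^{c_i}},\qquad x>0,$$ with $0<\omega_i<1$ and $\lambda_i,a_i,b_i,c_i>0$. Let $r_1,r_2\in\{1,2\}$, let $C>0$ be a fixed constant, and for $\mu_1,\mu_2>0$ let $\gamma_i=\mu_i I_i^{r_i}$ be the SNR of hop $i$ and $\gamma=\gamma_1\gamma_2/(\gamma_2+C)$ the end-to-end SNR of the fixed-gain dual-hop link, with distribution function $F_\gamma$. For $n\ge1$, $\delta,p,q_1,\dots,q_n>0$ the average bit-error rate (BER) is $$P_e=\frac{\delta}{2\Gamma(p)}\sum_{k=1}^n\mathbb E[\Gamma(p,q_k\gamma)],\qquad \Gamma(p,x)=\int_x^\infty t^{p-1}e^{-t}\,dt .$$ Put $$B=\frac{\omega_1}{\lambda_1^{r_1a_2c_2/r_2}}\Gamma\Big(1-\frac{r_1a_2c_2}{r_2}\Big)+\frac{1-\omega_1}{\Gamma(a_1)\,b_1^{r_1a_2c_2/r_2}}\Gamma\Big(a_1-\frac{r_1a_2c_2}{c_1r_2}\Big),$$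 $$F^\infty(x)=\omega_1\Big(\frac{x}{\lambda_1^{r_1}\mu_1}\Big)^{\frac1{r_1}}+\frac{1-\omega_1}{\Gamma(a_1+1)}\Big(\frac{x}{b_1^{r_1}\mu_1}\Big)^{\frac{a_1c_1}{r_1}}+\frac{\omega_2(1-\omega_1)}{\Gamma(a_1)}\Gamma\Big(a_1-\frac{r_1}{c_1r_2}\Big)\Big(\frac{Cx}{b_1^{r_1}\lambda_2^{r_2}\mu_1\mu_2}\Big)^{\frac1{r_2}}+\frac{(1-\omega_2)B}{\Gamma(a_2+1)}\Big(\frac{Cx}{b_2^{r_2}\mu_1\mu_2}\Big)^{\frac{a_2c_2}{r_2}}$$ (the high-SNR expression of $F_\gamma$) and $$P_e^\infty=\frac{\delta\omega_1\Gamma(p+\frac1{r_1})}{2\Gamma(p)}\sum_{k=1}^n\Big(\frac{1}{q_k\lambda_1^{r_1}\mu_1}\Big)^{\frac1{r_1}}+\frac{\delta(1-\omega_1)\Gamma(p+\frac{a_1c_1}{r_1})}{2\Gamma(a_1+1)\Gamma(p)}\sum_{k=1}^n\Big(\frac{1}{q_kb_1^{r_1}\mu_1}\Big)^{\frac{a_1c_1}{r_1}}$$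 $$\quad+\frac{\delta\omega_2(1-\omega_1)\Gamma(a_1-\frac{r_1}{c_1r_2})\Gamma(p+\frac1{r_2})}{2\Gamma(a_1)\Gamma(p)}\sum_{k=1}^n\Big(\frac{C}{q_kb_1^{r_1}\lambda_2^{r_2}\mu_1\mu_2}\Big)^{\frac1{r_2}}+\frac{\delta(1-\omega_2)\Gamma(p+\frac{a_2c_2}{r_2})}{2\Gamma(a_2+1)\Gamma(p)}\,B\sum_{k=1}^n\Big(\frac{C}{q_kb_2^{r_2}\mu_1\mu_2}\Big)^{\frac{a_2c_2}{r_2}},$$ where a summand with the Gamma function at one of its poles is read as $0$. Then: 1. For all $\mu_1,\mu_2>0$, $\displaystyle P_e=\frac{\delta}{2\Gamma(p)}\sum_{k=1}^nq_k^p\int_0^\infty x^{p-1}e^{-q_kx}F_\gamma(x)\,dx.$ 2. For all $\mu_1,\mu_2>0$, substituting $F^\infty$ for $F_\gamma$ in this formula gives $n$ absolutely convergent integrals, and the value of the formula is then exactly $P_e^\infty$. 3. $P_e\sim P_e^\infty$ (the ratio tends to $1$) as $\mu_1,\mu_2\to\infty$ in any way such that, with $\alpha=\min(1,a_1c_1)/r_1$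 and $\beta=\min(1,a_2c_2)/r_2$: (i) if $\alpha=\beta$, then $\log\mu_1=o(\mu_2^{\alpha})$; (ii) if $a_2c_2\ge1$ and $1/r_2<\alpha$, then $(\mu_1\mu_2)^{-1/r_2}=o(\mu_1^{-\alpha})$. (For $\mu_1\asymp\mu_2$, (i) always holds, and (ii) holds unless $r_1=1$, $r_2=2$, $a_1c_1\ge1$ and $a_2c_2\ge1$; in every case both hold when $\mu_1=o(\mu_2)$.) -/

import Mathlib

open MeasureTheory ProbabilityTheory Set Filter Asymptotics

noncomputable section

namespace UWOC

/-- Parameters of a mixture Exponential-Generalized Gamma (EGG) distribution: `w` is the weight of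
the exponential component, `lam` its mean, and `a`, `b`, `c` are the parameters of the generalized
Gamma component. -/
structure EGG where
  w : ℝ
  lam : ℝ
  a : ℝ
  b : ℝ
  c : ℝ
  w_pos : 0 < w
  w_lt_one : w < 1
  lam_pos : 0 < lam
  a_pos : 0 < a
  b_pos : 0 < b
  c_pos : 0 < c

/-- The EGG probability density function at `x > 0`. -/
def EGG.pdf (H : EGG) (x : ℝ) : ℝ :=
  H.w / H.lam * Real.exp (-x / H.lam)
    + (1 - H.w) * (H.c * x ^ (H.a * H.c - 1) / (H.b ^ (H.a * H.c) * Real.Gamma H.a))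
      * Real.exp (-(x / H.b) ^ H.c)

/-- The EGG distribution: the law on `(0, ∞)` with density `EGG.pdf`. -/
def EGG.law (H : EGG) : Measure ℝ :=
  (volume.restrict (Ioi 0)).withDensity fun x => ENNReal.ofReal (H.pdf x)

/-- The diversity order `min (1 / r, a c / r)` of one hop: the smaller of the two exponents
of `x / μ` in the small-argument behaviour of the distribution function of `μ I ^ r`,
`I` having the EGG distribution. -/
def EGG.order (H : EGG) (r : ℕ) : ℝ :=
  min 1 (H.a * H.c) / r

/-- Instantaneous SNR of a hop with irradiance `x`, average electrical SNR `μ` and detection type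
`r` (`r = 1`: heterodyne, `r = 2`: IM/DD). -/
def hopSNR (μ : ℝ) (r : ℕ) (x : ℝ) : ℝ :=
  μ * x ^ r

/-- End-to-end SNR `γ₁ γ₂ / (γ₂ + C)` of the dual-hop link with a fixed gain relay, where `x₁` and
`x₂` are the irradiances of the two hops. -/
def endSNR (r₁ r₂ : ℕ) (C μ₁ μ₂ x₁ x₂ : ℝ) : ℝ :=
  hopSNR μ₁ r₁ x₁ * hopSNR μ₂ r₂ x₂ / (hopSNR μ₂ r₂ x₂ + C)

/-- Upper incomplete Gamma function `Γ(p, x)`, for `p > 0` and `x ≥ 0`. -/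
def upperGamma (p x : ℝ) : ℝ :=
  ∫ t in Ioi x, t ^ (p - 1) * Real.exp (-t)

/-- Parameters of a modulation scheme: the average BER with distribution of the SNR `γ` is
`δ / (2 Γ(p)) * ∑ k, E[Γ(p, q k * γ)]`. -/
structure Modulation where
  n : ℕ
  δ : ℝ
  p : ℝ
  q : Fin n → ℝ
  n_pos : 0 < n
  δ_pos : 0 < δ
  p_pos : 0 < p
  q_pos : ∀ k, 0 < q k

/-- The average BER when the SNR is the random variable `γ` on the probability space `(Ω, P)`. -/
def Modulation.avgBER (M : Modulation) {Ω : Type*} [MeasurableSpace Ω] (P : Measure Ω)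
    (γ : Ω → ℝ) : ℝ :=
  M.δ / (2 * Real.Gamma M.p) * ∑ k, ∫ o, upperGamma M.p (M.q k * γ o) ∂P

/-- The cumulative distribution function of the random variable `γ`. -/
def cdfOf {Ω : Type*} [MeasurableSpace Ω] (P : Measure Ω) (γ : Ω → ℝ) (x : ℝ) : ℝ :=
  P.real {o | γ o ≤ x}

/-- The form of the average BER obtained by integration by parts, as a functional of a function `F`
in the place of the cumulative distribution function of the SNR. -/
def Modulation.berOfCDF (M : Modulation) (F : ℝ → ℝ) : ℝ :=
  M.δ / (2 * Real.Gamma M.p)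
    * ∑ k, M.q k ^ M.p * ∫ x in Ioi 0, x ^ (M.p - 1) * Real.exp (-(M.q k * x)) * F x

/-- The high-SNR expression of the cumulative distribution function of the end-to-end SNR.
A summand in which the Gamma function has a pole is read as zero (`Real.Gamma (-m) = 0`). -/
def cdfHighSNR (H₁ H₂ : EGG) (r₁ r₂ : ℕ) (C μ₁ μ₂ x : ℝ) : ℝ :=
  H₁.w * (x / (H₁.lam ^ r₁ * μ₁)) ^ (1 / r₁ : ℝ)
  + (1 - H₁.w) / Real.Gamma (H₁.a + 1) * (x / (H₁.b ^ r₁ * μ₁)) ^ (H₁.a * H₁.c / r₁)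
  + H₂.w * (1 - H₁.w) / Real.Gamma H₁.a * Real.Gamma (H₁.a - r₁ / (H₁.c * r₂))
      * (C * x / (H₁.b ^ r₁ * H₂.lam ^ r₂ * μ₁ * μ₂)) ^ (1 / r₂ : ℝ)
  + (1 - H₂.w) / Real.Gamma (H₂.a + 1)
      * (C * x / (H₂.b ^ r₂ * μ₁ * μ₂)) ^ (H₂.a * H₂.c / r₂)
      * (H₁.w / H₁.lam ^ (r₁ * H₂.a * H₂.c / r₂) * Real.Gamma (1 - r₁ * H₂.a * H₂.c / r₂)
        + (1 - H₁.w) / (Real.Gamma H₁.a * H₁.b ^ (r₁ * H₂.a * H₂.c / r₂))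
          * Real.Gamma (H₁.a - r₁ * H₂.a * H₂.c / (H₁.c * r₂)))

/-- The high-SNR expression of the average BER, with the same convention at the poles of the
Gamma function. -/
def Modulation.berHighSNR (M : Modulation) (H₁ H₂ : EGG) (r₁ r₂ : ℕ) (C μ₁ μ₂ : ℝ) : ℝ :=
  M.δ * H₁.w * Real.Gamma (M.p + 1 / r₁) / (2 * Real.Gamma M.p)
      * ∑ k, (1 / (M.q k * H₁.lam ^ r₁ * μ₁)) ^ (1 / r₁ : ℝ)
  + M.δ * (1 - H₁.w) * Real.Gamma (M.p + H₁.a * H₁.c / r₁)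
        / (2 * Real.Gamma (H₁.a + 1) * Real.Gamma M.p)
      * ∑ k, (1 / (M.q k * H₁.b ^ r₁ * μ₁)) ^ (H₁.a * H₁.c / r₁)
  + M.δ * H₂.w * (1 - H₁.w) * Real.Gamma (H₁.a - r₁ / (H₁.c * r₂)) * Real.Gamma (M.p + 1 / r₂)
        / (2 * Real.Gamma H₁.a * Real.Gamma M.p)
      * ∑ k, (C / (M.q k * H₁.b ^ r₁ * H₂.lam ^ r₂ * μ₁ * μ₂)) ^ (1 / r₂ : ℝ)
  + M.δ * (1 - H₂.w) * Real.Gamma (M.p + H₂.a * H₂.c / r₂)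
        / (2 * Real.Gamma (H₂.a + 1) * Real.Gamma M.p)
      * (H₁.w / H₁.lam ^ (r₁ * H₂.a * H₂.c / r₂) * Real.Gamma (1 - r₁ * H₂.a * H₂.c / r₂)
        + (1 - H₁.w) / (Real.Gamma H₁.a * H₁.b ^ (r₁ * H₂.a * H₂.c / r₂))
          * Real.Gamma (H₁.a - r₁ * H₂.a * H₂.c / (H₁.c * r₂)))
      * ∑ k, (C / (M.q k * H₂.b ^ r₂ * μ₁ * μ₂)) ^ (H₂.a * H₂.c / r₂)

end UWOC

end

/-! ### Gamma-weighted integrals: the BER as a functional of the distribution function, and its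
value at the high-SNR expression. -/

noncomputable section

namespace UWOC

/-! Part 1 is Fubini: `Γ(p, qγ)` is `q ^ p` times the integral of the weight `x ^ (p - 1) e ^ (-q
x)` over `x ≥ γ`, and the mean of the indicator of `γ ≤ x` is the distribution function. Part 2
integrates four powers of `x` against this weight. Only values `Γ(p + s)` with `s > 0` arise; the
Gamma factors that may sit at poles are constants.

For part 3, write `u = x / μ₁` and `z = C / (μ₂ I₂ ^ r₂)`. Then `γ ≤ x` means `I₁ ^ r₁ ≤ u + u z`.
Let `G` be the distribution function of `I₁ ^ r₁`. The EGG density is `O(x ^ (θ - 1))` with `θ =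
min(1, a c)`, so increments of `G` over length `h` are at most `D h ^ α`, and `G(s) ~ κ s ^ α` at
`0`. Hence `G(u + u z) - G(u) - G(u z)` is bounded by `D u ^ α min(1, z ^ α)`, whose mean over `I₂`
is `o(μ₁ ^ (-α))` for fixed `x`, by dominated convergence and without any moment of `I₂`
(`exists_abs_integral_powCdf_sub_le`, `tendsto_truncMoment`). Integrated against the weight, each
BER summand becomes a one-hop term of exact order `μ₁ ^ (-α)`, plus a term `prodBER` at `s = 1 / (μ₁
μ₂)` for the product `I₁ ^ r₁ I₂ ^ r₂`, plus `o(μ₁ ^ (-α))`.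

The product term has three regimes. If `α < β`, it is `O(s ^ α)`, hence negligible. If `α = β`, a
bound `D s ^ ρ / (α - ρ)` uniform in `ρ < α` gives `O(s ^ α log(1 / s))`, negligible under (i). If
`β < α`, it is asymptotic to `K s ^ β`, where `K` contains `E[I₁ ^ (-r₁ β)]`. For `a₂ c₂ < 1` this
is exactly the fourth high-SNR term. For `a₂ c₂ ≥ 1` one has `β = 1 / r₂`, and (ii) makes the term
negligible; the third high-SNR coefficient could not be matched with `K`, since it keeps only the
generalized Gamma part of that moment. -/

lemma integrableOn_gammaWeight {p q s : ℝ} (hps : 0 < p + s) (hq : 0 < q) :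
    IntegrableOn (fun x : ℝ => x ^ (p - 1) * Real.exp (-(q * x)) * x ^ s) (Ioi 0) := by
  have h := integrableOn_rpow_mul_exp_neg_mul_rpow (p := 1) (s := p + s - 1) (by linarith)
    one_pos hq
  refine h.congr_fun (fun x hx => ?_) measurableSet_Ioi
  have hx : 0 < x := hx
  simp only [Real.rpow_one]
  rw [show p + s - 1 = (p - 1) + s by ring, Real.rpow_add hx]
  ring_nf

lemma integral_gammaWeight {p q s : ℝ} (hps : 0 < p + s) (hq : 0 < q) :
    ∫ x in Ioi (0 : ℝ), x ^ (p - 1) * Real.exp (-(q * x)) * x ^ s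
      = Real.Gamma (p + s) * q ^ (-(p + s)) := by
  have h := Real.integral_rpow_mul_exp_neg_mul_Ioi hps hq
  rw [Real.rpow_neg hq.le, ← Real.inv_rpow hq.le, mul_comm, ← one_div, ← h]
  refine setIntegral_congr_fun measurableSet_Ioi (fun x hx => ?_)
  have hx : 0 < x := hx
  rw [show p + s - 1 = (p - 1) + s by ring, Real.rpow_add hx]
  ring_nf

lemma integrableOn_gammaWeight_zero {p q : ℝ} (hp : 0 < p) (hq : 0 < q) :
    IntegrableOn (fun x : ℝ => x ^ (p - 1) * Real.exp (-(q * x))) (Ioi 0) := by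
  simpa using integrableOn_gammaWeight (s := 0) (by simpa using hp) hq

lemma gammaWeight_nonneg {p q x : ℝ} (hx : 0 < x) :
    0 ≤ x ^ (p - 1) * Real.exp (-(q * x)) := by positivity

lemma integrableOn_gammaWeight_mul_rpow {p q s A : ℝ} (hps : 0 < p + s) (hq : 0 < q)
    (hA : 0 ≤ A) :
    IntegrableOn (fun x : ℝ => x ^ (p - 1) * Real.exp (-(q * x)) * (A * x) ^ s) (Ioi 0) := by
  have h : IntegrableOn (fun x : ℝ => A ^ s * (x ^ (p - 1) * Real.exp (-(q * x)) * x ^ s)) (Ioi 0) :=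
    (integrableOn_gammaWeight hps hq).integrable.const_mul (A ^ s)
  refine h.congr_fun (fun x hx => ?_) measurableSet_Ioi
  have hx : 0 < x := hx
  simp only
  rw [Real.mul_rpow hA hx.le]
  ring

lemma integral_gammaWeight_mul_rpow {p q s A : ℝ} (hps : 0 < p + s) (hq : 0 < q)
    (hA : 0 ≤ A) :
    q ^ p * ∫ x in Ioi (0 : ℝ), x ^ (p - 1) * Real.exp (-(q * x)) * (A * x) ^ s
      = Real.Gamma (p + s) * (A / q) ^ s := by
  have : ∫ x in Ioi (0 : ℝ), x ^ (p - 1) * Real.exp (-(q * x)) * (A * x) ^ s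
      = A ^ s * ∫ x in Ioi (0 : ℝ), x ^ (p - 1) * Real.exp (-(q * x)) * x ^ s := by
    rw [← integral_const_mul]
    refine setIntegral_congr_fun measurableSet_Ioi (fun x hx => ?_)
    have hx : 0 < x := hx
    rw [Real.mul_rpow hA hx.le]
    ring
  rw [this, integral_gammaWeight hps hq, Real.div_rpow hA hq.le, neg_add, Real.rpow_add hq,
    Real.rpow_neg hq.le, Real.rpow_neg hq.le]
  have := (Real.rpow_pos_of_pos hq p).ne'
  have := (Real.rpow_pos_of_pos hq s).ne'
  field_simp

/-- Substitution `t = q x`. The lower limit becomes an indicator so that the domain no longer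
depends on `y` and Fubini applies when `y` is random. -/
lemma upperGamma_mul_eq {p q y : ℝ} (hq : 0 < q) (hy : 0 ≤ y) :
    upperGamma p (q * y) = q ^ p * ∫ x in Ioi (0 : ℝ),
      x ^ (p - 1) * Real.exp (-(q * x)) * (Ici y).indicator 1 x := by
  have h := integral_comp_mul_left_Ioi (fun t : ℝ => t ^ (p - 1) * Real.exp (-t)) y hq
  have h2 : ∫ x in Ioi (0 : ℝ), x ^ (p - 1) * Real.exp (-(q * x)) * (Ici y).indicator 1 x
      = ∫ x in Ioi y, x ^ (p - 1) * Real.exp (-(q * x)) := by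
    rw [← integral_Ici_eq_integral_Ioi]
    have : ∀ x : ℝ, x ^ (p - 1) * Real.exp (-(q * x)) * (Ici y).indicator 1 x
        = (Ici y).indicator (fun x => x ^ (p - 1) * Real.exp (-(q * x))) x := by
      intro x
      by_cases hx : x ∈ Ici y <;> simp [hx]
    simp_rw [this]
    rw [← integral_Ici_eq_integral_Ioi, setIntegral_indicator measurableSet_Ici,
      inter_eq_right.mpr (Ici_subset_Ici.mpr hy)]
  have h3 : ∫ x in Ioi y, (q * x) ^ (p - 1) * Real.exp (-(q * x))
      = q ^ (p - 1) * ∫ x in Ioi y, x ^ (p - 1) * Real.exp (-(q * x)) := by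
    rw [← integral_const_mul]
    refine setIntegral_congr_fun measurableSet_Ioi (fun x hx => ?_)
    have hx : 0 < x := lt_of_le_of_lt hy hx
    rw [Real.mul_rpow hq.le hx.le]
    ring
  rw [h2, upperGamma]
  rw [h3, smul_eq_mul] at h
  have : q ^ p = q * q ^ (p - 1) := by
    rw [Real.rpow_sub_one hq.ne']; field_simp
  rw [this, mul_assoc, h]
  field_simp

/-- Fubini takes the place of integration by parts, so no regularity of the distribution function is
needed. -/
lemma integral_upperGamma_of_measurable {Ω : Type*} [MeasurableSpace Ω] (P : Measure Ω)
    [IsProbabilityMeasure P] {γ : Ω → ℝ} (hγ : Measurable γ) (h0 : ∀ᵐ o ∂P, 0 ≤ γ o)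
    {p q : ℝ} (hp : 0 < p) (hq : 0 < q) :
    ∫ o, upperGamma p (q * γ o) ∂P
      = q ^ p * ∫ x in Ioi 0, x ^ (p - 1) * Real.exp (-(q * x)) * cdfOf P γ x := by
  rw [integral_congr_ae (h0.mono fun o ho => upperGamma_mul_eq hq ho), integral_const_mul]
  congr 1
  rw [integral_integral_swap]
  · congr 1
    ext x
    rw [integral_const_mul, cdfOf]
    congr 1
    have : (fun o => (Ici (γ o)).indicator (1 : ℝ → ℝ) x)
        = {o | γ o ≤ x}.indicator (1 : Ω → ℝ) := by
      ext o; simp [indicator]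
    rw [this]
    exact integral_indicator_one (hγ measurableSet_Iic)
  · have hs : MeasurableSet {z : Ω × ℝ | γ z.1 ≤ z.2} :=
      measurableSet_le (hγ.comp measurable_fst) measurable_snd
    have hw : Integrable (fun z : Ω × ℝ => z.2 ^ (p - 1) * Real.exp (-(q * z.2)))
        (P.prod (volume.restrict (Ioi 0))) :=
      (integrableOn_gammaWeight_zero hp hq).integrable.comp_snd P
    refine (hw.indicator hs).congr (ae_of_all _ fun z => ?_)
    by_cases hz : γ z.1 ≤ z.2 <;> simp [hz, Function.uncurry]

lemma integral_upperGamma {Ω : Type*} [MeasurableSpace Ω] (P : Measure Ω)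
    [IsProbabilityMeasure P] {γ : Ω → ℝ} (hγ : AEMeasurable γ P) (h0 : ∀ᵐ o ∂P, 0 ≤ γ o)
    {p q : ℝ} (hp : 0 < p) (hq : 0 < q) :
    ∫ o, upperGamma p (q * γ o) ∂P
      = q ^ p * ∫ x in Ioi 0, x ^ (p - 1) * Real.exp (-(q * x)) * cdfOf P γ x := by
  have hc : cdfOf P γ = cdfOf P (hγ.mk γ) := by
    ext x
    refine measureReal_congr ?_
    filter_upwards [hγ.ae_eq_mk] with o ho
    show (γ o ≤ x) = (hγ.mk γ o ≤ x)
    rw [ho]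
  rw [hc, ← integral_upperGamma_of_measurable P hγ.measurable_mk _ hp hq]
  · refine integral_congr_ae ?_
    filter_upwards [hγ.ae_eq_mk] with o ho
    rw [ho]
  · filter_upwards [h0, hγ.ae_eq_mk] with o ho ho'
    rwa [← ho']

lemma Modulation.avgBER_eq_berOfCDF (M : Modulation) {Ω : Type*} [MeasurableSpace Ω]
    (P : Measure Ω) [IsProbabilityMeasure P] {γ : Ω → ℝ} (hγ : AEMeasurable γ P)
    (h0 : ∀ᵐ o ∂P, 0 ≤ γ o) :
    M.avgBER P γ = M.berOfCDF (cdfOf P γ) := by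
  rw [Modulation.avgBER, Modulation.berOfCDF]
  congr 1
  exact Finset.sum_congr rfl fun k _ => integral_upperGamma P hγ h0 M.p_pos (M.q_pos k)

section HighSNR

variable (M : Modulation) (H₁ H₂ : EGG) {r₁ r₂ : ℕ} {C μ₁ μ₂ : ℝ}

/-- Brings every summand to the shape `c * (A * x) ^ s` expected by `highSNR_term`. -/
lemma cdfHighSNR_eq (x : ℝ) : cdfHighSNR H₁ H₂ r₁ r₂ C μ₁ μ₂ x
    = H₁.w * (1 / (H₁.lam ^ r₁ * μ₁) * x) ^ (1 / r₁ : ℝ)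
  + (1 - H₁.w) / Real.Gamma (H₁.a + 1) * (1 / (H₁.b ^ r₁ * μ₁) * x) ^ (H₁.a * H₁.c / r₁)
  + H₂.w * (1 - H₁.w) / Real.Gamma H₁.a * Real.Gamma (H₁.a - r₁ / (H₁.c * r₂))
      * (C / (H₁.b ^ r₁ * H₂.lam ^ r₂ * μ₁ * μ₂) * x) ^ (1 / r₂ : ℝ)
  + (1 - H₂.w) / Real.Gamma (H₂.a + 1)
      * (H₁.w / H₁.lam ^ (r₁ * H₂.a * H₂.c / r₂) * Real.Gamma (1 - r₁ * H₂.a * H₂.c / r₂)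
        + (1 - H₁.w) / (Real.Gamma H₁.a * H₁.b ^ (r₁ * H₂.a * H₂.c / r₂))
          * Real.Gamma (H₁.a - r₁ * H₂.a * H₂.c / (H₁.c * r₂)))
      * (C / (H₂.b ^ r₂ * μ₁ * μ₂) * x) ^ (H₂.a * H₂.c / r₂) := by
  rw [cdfHighSNR]
  simp only [div_mul_eq_mul_div, one_mul]
  ring

lemma highSNR_term (c₁ c₂ c₃ c₄ s₁ s₂ s₃ s₄ A₁ A₂ A₃ A₄ : ℝ) {p q : ℝ} (hp : 0 < p) (hq : 0 < q)
    (h₁ : 0 < s₁) (h₂ : 0 < s₂) (h₃ : 0 < s₃) (h₄ : 0 < s₄)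
    (hA₁ : 0 ≤ A₁) (hA₂ : 0 ≤ A₂) (hA₃ : 0 ≤ A₃) (hA₄ : 0 ≤ A₄) :
    IntegrableOn (fun x : ℝ => x ^ (p - 1) * Real.exp (-(q * x)) * (c₁ * (A₁ * x) ^ s₁
      + c₂ * (A₂ * x) ^ s₂ + c₃ * (A₃ * x) ^ s₃ + c₄ * (A₄ * x) ^ s₄)) (Ioi 0) ∧
    q ^ p * ∫ x in Ioi (0 : ℝ), x ^ (p - 1) * Real.exp (-(q * x)) * (c₁ * (A₁ * x) ^ s₁
      + c₂ * (A₂ * x) ^ s₂ + c₃ * (A₃ * x) ^ s₃ + c₄ * (A₄ * x) ^ s₄)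
      = c₁ * (Real.Gamma (p + s₁) * (A₁ / q) ^ s₁) + c₂ * (Real.Gamma (p + s₂) * (A₂ / q) ^ s₂)
        + c₃ * (Real.Gamma (p + s₃) * (A₃ / q) ^ s₃)
        + c₄ * (Real.Gamma (p + s₄) * (A₄ / q) ^ s₄) := by
  have i₁ := (integrableOn_gammaWeight_mul_rpow (add_pos hp h₁) hq hA₁).integrable.const_mul c₁
  have i₂ := (integrableOn_gammaWeight_mul_rpow (add_pos hp h₂) hq hA₂).integrable.const_mul c₂
  have i₃ := (integrableOn_gammaWeight_mul_rpow (add_pos hp h₃) hq hA₃).integrable.const_mul c₃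
  have i₄ := (integrableOn_gammaWeight_mul_rpow (add_pos hp h₄) hq hA₄).integrable.const_mul c₄
  have i₁₂ := i₁.add i₂
  have i₁₃ := i₁₂.add i₃
  simp only [Pi.add_def] at i₁₂ i₁₃
  have e : (fun x : ℝ => x ^ (p - 1) * Real.exp (-(q * x)) * (c₁ * (A₁ * x) ^ s₁
      + c₂ * (A₂ * x) ^ s₂ + c₃ * (A₃ * x) ^ s₃ + c₄ * (A₄ * x) ^ s₄))
      = fun x => c₁ * (x ^ (p - 1) * Real.exp (-(q * x)) * (A₁ * x) ^ s₁)
        + c₂ * (x ^ (p - 1) * Real.exp (-(q * x)) * (A₂ * x) ^ s₂)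
        + c₃ * (x ^ (p - 1) * Real.exp (-(q * x)) * (A₃ * x) ^ s₃)
        + c₄ * (x ^ (p - 1) * Real.exp (-(q * x)) * (A₄ * x) ^ s₄) := by
    ext x; ring
  rw [e]
  refine ⟨i₁₃.add i₄, ?_⟩
  rw [integral_add i₁₃ i₄, integral_add i₁₂ i₃, integral_add i₁ i₂]
  simp only [integral_const_mul]
  rw [← integral_gammaWeight_mul_rpow (add_pos hp h₁) hq hA₁,
    ← integral_gammaWeight_mul_rpow (add_pos hp h₂) hq hA₂,
    ← integral_gammaWeight_mul_rpow (add_pos hp h₃) hq hA₃,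
    ← integral_gammaWeight_mul_rpow (add_pos hp h₄) hq hA₄]
  ring

/-- The contribution of `q = M.q k` to the sum in `M.berHighSNR`. -/
def highSNRSummand (H₁ H₂ : EGG) (r₁ r₂ : ℕ) (C p q μ₁ μ₂ : ℝ) : ℝ :=
  H₁.w * (Real.Gamma (p + 1 / r₁) * (1 / (H₁.lam ^ r₁ * μ₁) / q) ^ (1 / r₁ : ℝ))
  + (1 - H₁.w) / Real.Gamma (H₁.a + 1) * (Real.Gamma (p + H₁.a * H₁.c / r₁)
      * (1 / (H₁.b ^ r₁ * μ₁) / q) ^ (H₁.a * H₁.c / r₁))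
  + H₂.w * (1 - H₁.w) / Real.Gamma H₁.a * Real.Gamma (H₁.a - r₁ / (H₁.c * r₂))
      * (Real.Gamma (p + 1 / r₂)
      * (C / (H₁.b ^ r₁ * H₂.lam ^ r₂ * μ₁ * μ₂) / q) ^ (1 / r₂ : ℝ))
  + (1 - H₂.w) / Real.Gamma (H₂.a + 1)
      * (H₁.w / H₁.lam ^ (r₁ * H₂.a * H₂.c / r₂) * Real.Gamma (1 - r₁ * H₂.a * H₂.c / r₂)
        + (1 - H₁.w) / (Real.Gamma H₁.a * H₁.b ^ (r₁ * H₂.a * H₂.c / r₂))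
          * Real.Gamma (H₁.a - r₁ * H₂.a * H₂.c / (H₁.c * r₂)))
      * (Real.Gamma (p + H₂.a * H₂.c / r₂)
      * (C / (H₂.b ^ r₂ * μ₁ * μ₂) / q) ^ (H₂.a * H₂.c / r₂))

lemma integral_cdfHighSNR (hr₁ : r₁ ≠ 0) (hr₂ : r₂ ≠ 0) (hC : 0 < C) (hμ₁ : 0 < μ₁)
    (hμ₂ : 0 < μ₂) {p q : ℝ} (hp : 0 < p) (hq : 0 < q) :
    IntegrableOn (fun x => x ^ (p - 1) * Real.exp (-(q * x))
        * cdfHighSNR H₁ H₂ r₁ r₂ C μ₁ μ₂ x) (Ioi 0) ∧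
    q ^ p * ∫ x in Ioi (0 : ℝ), x ^ (p - 1) * Real.exp (-(q * x))
        * cdfHighSNR H₁ H₂ r₁ r₂ C μ₁ μ₂ x = highSNRSummand H₁ H₂ r₁ r₂ C p q μ₁ μ₂ := by
  have := H₁.lam_pos; have := H₁.a_pos; have := H₁.b_pos; have := H₁.c_pos
  have := H₂.lam_pos; have := H₂.a_pos; have := H₂.b_pos; have := H₂.c_pos
  have : (0 : ℝ) < r₁ := by positivity
  have : (0 : ℝ) < r₂ := by positivity
  simp only [cdfHighSNR_eq]
  exact highSNR_term _ _ _ _ _ _ _ _ _ _ _ _ hp hq (by positivity) (by positivity)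
    (by positivity) (by positivity) (by positivity) (by positivity) (by positivity) (by positivity)

lemma Modulation.berHighSNR_eq (μ₁ μ₂ : ℝ) : M.berHighSNR H₁ H₂ r₁ r₂ C μ₁ μ₂
    = M.δ / (2 * Real.Gamma M.p) * ∑ k, highSNRSummand H₁ H₂ r₁ r₂ C M.p (M.q k) μ₁ μ₂ := by
  have e : ∀ (c q A : ℝ), c / (q * A) = c / A / q := fun c q A => by
    rw [div_div, mul_comm]
  simp only [Modulation.berHighSNR, highSNRSummand, Finset.sum_add_distrib, ← Finset.mul_sum,
    mul_assoc (M.q _), e]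
  have hΓ := (Real.Gamma_pos_of_pos M.p_pos).ne'
  have hΓ₁ := (Real.Gamma_pos_of_pos H₁.a_pos).ne'
  have hΓ₁' := (Real.Gamma_pos_of_pos (add_pos H₁.a_pos one_pos)).ne'
  have hΓ₂' := (Real.Gamma_pos_of_pos (add_pos H₂.a_pos one_pos)).ne'
  rw [mul_add, mul_add, mul_add]
  congr 1
  · congr 1
    · ring
    · field_simp
  · field_simp

lemma Modulation.berOfCDF_cdfHighSNR (hr₁ : r₁ ≠ 0) (hr₂ : r₂ ≠ 0) (hC : 0 < C) (hμ₁ : 0 < μ₁)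
    (hμ₂ : 0 < μ₂) :
    M.berOfCDF (cdfHighSNR H₁ H₂ r₁ r₂ C μ₁ μ₂) = M.berHighSNR H₁ H₂ r₁ r₂ C μ₁ μ₂ := by
  rw [Modulation.berOfCDF, Modulation.berHighSNR_eq]
  congr 1
  exact Finset.sum_congr rfl fun k _ =>
    (integral_cdfHighSNR H₁ H₂ hr₁ hr₂ hC hμ₁ hμ₂ M.p_pos (M.q_pos k)).2

end HighSNR

end UWOC

end

/-! ### Small-argument behaviour of the EGG distribution function. -/

noncomputable section

namespace UWOC

/-- With `u = (x / b) ^ c` the power is `b ^ s * u ^ (s / c)`; raising `t ≤ e ^ t` at `t = u / (s /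
c)` to the power `s / c` gives a bound by a constant times `e ^ u`. -/
lemma exists_rpow_mul_exp_neg_le {s b c : ℝ} (hs : 0 ≤ s) (hb : 0 < b) (hc : 0 < c) :
    ∃ D : ℝ, 0 < D ∧ ∀ x : ℝ, 0 < x → x ^ s * Real.exp (-(x / b) ^ c) ≤ D := by
  rcases hs.eq_or_lt with rfl | hs
  · refine ⟨1, one_pos, fun x hx => ?_⟩
    rw [Real.rpow_zero, one_mul, Real.exp_le_one_iff]
    exact neg_nonpos.mpr (by positivity)
  · have ht : 0 < s / c := by positivity
    refine ⟨b ^ s * (s / c) ^ (s / c), by positivity, fun x hx => ?_⟩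
    set u := (x / b) ^ c with hu
    have hu0 : 0 < u := by positivity
    have hx' : x ^ s = b ^ s * u ^ (s / c) := by
      rw [hu, ← Real.rpow_mul (by positivity), mul_div_cancel₀ _ hc.ne',
        Real.div_rpow hx.le hb.le]
      field_simp
    have h1 : u / (s / c) ≤ Real.exp (u / (s / c)) := by
      linarith [Real.add_one_le_exp (u / (s / c))]
    have h2 : u ^ (s / c) ≤ (s / c) ^ (s / c) * Real.exp u := by
      have := Real.rpow_le_rpow (by positivity) h1 ht.le
      rw [← Real.exp_mul, div_mul_cancel₀ _ ht.ne', Real.div_rpow hu0.le ht.le,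
        div_le_iff₀ (by positivity)] at this
      linarith
    calc x ^ s * Real.exp (-u) = b ^ s * (u ^ (s / c) * Real.exp (-u)) := by rw [hx']; ring
      _ ≤ b ^ s * ((s / c) ^ (s / c) * Real.exp u * Real.exp (-u)) := by gcongr
      _ = b ^ s * (s / c) ^ (s / c) := by
        rw [mul_assoc ((s / c) ^ (s / c)), ← Real.exp_add, add_neg_cancel, Real.exp_zero, mul_one]

namespace EGG

variable (H : EGG)

/-- The exponent of `x` in the small-argument behaviour of the distribution function. -/
def expo : ℝ := min 1 (H.a * H.c)

lemma expo_pos : 0 < H.expo := lt_min one_pos (mul_pos H.a_pos H.c_pos)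

lemma expo_le_one : H.expo ≤ 1 := min_le_left _ _

lemma expo_le_mul : H.expo ≤ H.a * H.c := min_le_right _ _

lemma order_eq (r : ℕ) : H.order r = H.expo / r := rfl

lemma order_pos {r : ℕ} (hr : r ≠ 0) : 0 < H.order r :=
  div_pos H.expo_pos (by positivity)

lemma order_le_one {r : ℕ} (hr : r ≠ 0) : H.order r ≤ 1 :=
  div_le_one_of_le₀ (H.expo_le_one.trans (by exact_mod_cast Nat.one_le_iff_ne_zero.mpr hr))
    (by positivity)

lemma measurable_pdf : Measurable H.pdf := by
  unfold EGG.pdf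
  fun_prop

lemma pdf_nonneg {x : ℝ} (hx : 0 < x) : 0 ≤ H.pdf x := by
  have := H.w_pos; have := H.w_lt_one; have := H.lam_pos; have := H.b_pos; have := H.c_pos
  have := Real.Gamma_pos_of_pos H.a_pos
  have : 0 < 1 - H.w := by linarith
  unfold EGG.pdf
  positivity

lemma law_ae_pos : ∀ᵐ x ∂H.law, 0 < x :=
  (withDensity_absolutelyContinuous _ _).ae_le (ae_restrict_mem measurableSet_Ioi)

/-- Once `x ^ (expo - 1)` is factored out, each component is a nonnegative power of `x` times a
decaying exponential, hence bounded. -/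
lemma exists_pdf_le : ∃ D : ℝ, 0 < D ∧ ∀ x, 0 < x → H.pdf x ≤ D * x ^ (H.expo - 1) := by
  have := H.w_pos; have := H.w_lt_one; have := H.lam_pos; have := H.b_pos; have := H.c_pos
  have := Real.Gamma_pos_of_pos H.a_pos
  have : 0 < 1 - H.w := by linarith
  obtain ⟨D₁, hD₁, h₁⟩ := exists_rpow_mul_exp_neg_le (s := 1 - H.expo)
    (sub_nonneg.mpr H.expo_le_one) H.lam_pos one_pos
  obtain ⟨D₂, hD₂, h₂⟩ := exists_rpow_mul_exp_neg_le (s := H.a * H.c - H.expo)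
    (sub_nonneg.mpr H.expo_le_mul) H.b_pos H.c_pos
  refine ⟨H.w / H.lam * D₁ + (1 - H.w) * (H.c / (H.b ^ (H.a * H.c) * Real.Gamma H.a)) * D₂,
    by positivity, fun x hx => ?_⟩
  have e₁ : Real.exp (-x / H.lam)
      = x ^ (H.expo - 1) * (x ^ (1 - H.expo) * Real.exp (-(x / H.lam) ^ (1 : ℝ))) := by
    rw [← mul_assoc, ← Real.rpow_add hx, Real.rpow_one, neg_div]
    simp
  have e₂ : x ^ (H.a * H.c - 1) = x ^ (H.expo - 1) * x ^ (H.a * H.c - H.expo) := by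
    rw [← Real.rpow_add hx]
    ring_nf
  calc H.pdf x = H.w / H.lam * (x ^ (H.expo - 1)
        * (x ^ (1 - H.expo) * Real.exp (-(x / H.lam) ^ (1 : ℝ))))
      + (1 - H.w) * (H.c / (H.b ^ (H.a * H.c) * Real.Gamma H.a)) * (x ^ (H.expo - 1)
        * (x ^ (H.a * H.c - H.expo) * Real.exp (-(x / H.b) ^ H.c))) := by
        rw [← e₁, EGG.pdf, e₂]; ring
    _ ≤ H.w / H.lam * (x ^ (H.expo - 1) * D₁)
      + (1 - H.w) * (H.c / (H.b ^ (H.a * H.c) * Real.Gamma H.a)) * (x ^ (H.expo - 1) * D₂) := by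
        gcongr
        · exact h₁ x hx
        · exact h₂ x hx
    _ = _ := by ring

lemma intervalIntegrable_pdf {u v : ℝ} (hu : 0 ≤ u) (huv : u ≤ v) :
    IntervalIntegrable H.pdf volume u v := by
  obtain ⟨D, -, hD⟩ := H.exists_pdf_le
  have h := (intervalIntegral.intervalIntegrable_rpow' (a := u) (b := v)
    (show -1 < H.expo - 1 by linarith [H.expo_pos])).const_mul D
  rw [intervalIntegrable_iff_integrableOn_Ioc_of_le huv] at h ⊢
  refine Integrable.mono' h H.measurable_pdf.aestronglyMeasurable ?_
  filter_upwards [ae_restrict_mem measurableSet_Ioc] with x hx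
  have hx0 : 0 < x := hu.trans_lt hx.1
  rw [Real.norm_of_nonneg (H.pdf_nonneg hx0)]
  exact hD x hx0

lemma law_real_Ioc {u v : ℝ} (hu : 0 ≤ u) (huv : u ≤ v) :
    H.law.real (Ioc u v) = ∫ x in u..v, H.pdf x := by
  have hs : Ioc u v ∩ Ioi 0 = Ioc u v :=
    inter_eq_left.mpr fun x hx => hu.trans_lt hx.1
  rw [measureReal_def, EGG.law, withDensity_apply _ measurableSet_Ioc,
    Measure.restrict_restrict measurableSet_Ioc, hs, intervalIntegral.integral_of_le huv,
    integral_eq_lintegral_of_nonneg_ae]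
  · filter_upwards [ae_restrict_mem measurableSet_Ioc] with x hx
    exact H.pdf_nonneg (hu.trans_lt hx.1)
  · exact H.measurable_pdf.aestronglyMeasurable

lemma exists_integral_pdf_le : ∃ D : ℝ, 0 < D ∧ ∀ u v, 0 ≤ u → u ≤ v →
    ∫ x in u..v, H.pdf x ≤ D * (v ^ H.expo - u ^ H.expo) := by
  obtain ⟨D, hD0, hD⟩ := H.exists_pdf_le
  have hθ := H.expo_pos
  refine ⟨D / H.expo, by positivity, fun u v hu huv => ?_⟩
  have hr : -1 < H.expo - 1 := by linarith
  have h := (intervalIntegral.intervalIntegrable_rpow' (a := u) (b := v) hr).const_mul D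
  calc ∫ x in u..v, H.pdf x ≤ ∫ x in u..v, D * x ^ (H.expo - 1) := by
        refine intervalIntegral.integral_mono_on_of_le_Ioo huv (H.intervalIntegrable_pdf hu huv) h
          fun x hx => hD x (hu.trans_lt hx.1)
    _ = D / H.expo * (v ^ H.expo - u ^ H.expo) := by
        rw [intervalIntegral.integral_const_mul, integral_rpow (Or.inl hr), sub_add_cancel]
        ring

/-- The distribution function of the `r`-th power of an EGG random variable. -/
def powCdf (r : ℕ) (s : ℝ) : ℝ := H.law.real {x | x ^ r ≤ s}

lemma powCdf_eq {r : ℕ} (hr : r ≠ 0) {s : ℝ} (hs : 0 ≤ s) :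
    H.powCdf r s = ∫ x in 0..s ^ (1 / r : ℝ), H.pdf x := by
  rw [← H.law_real_Ioc le_rfl (by positivity), powCdf]
  refine measureReal_congr ?_
  filter_upwards [H.law_ae_pos] with x hx
  refine propext ?_
  show x ^ r ≤ s ↔ 0 < x ∧ x ≤ s ^ (1 / r : ℝ)
  rw [one_div, ← Real.rpow_natCast,
    Real.le_rpow_inv_iff_of_pos hx.le hs (by positivity)]
  exact ⟨fun h => ⟨hx, h⟩, fun h => h.2⟩

lemma powCdf_nonneg (r : ℕ) (s : ℝ) : 0 ≤ H.powCdf r s := measureReal_nonneg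

lemma powCdf_le_one [IsProbabilityMeasure H.law] (r : ℕ) (s : ℝ) : H.powCdf r s ≤ 1 :=
  measureReal_le_one

lemma powCdf_mono [IsProbabilityMeasure H.law] (r : ℕ) : Monotone (H.powCdf r) := fun s t hst =>
  measureReal_mono fun _ hx => le_trans hx hst

lemma powCdf_zero {r : ℕ} (hr : r ≠ 0) : H.powCdf r 0 = 0 := by
  rw [H.powCdf_eq hr le_rfl, Real.zero_rpow (by positivity), intervalIntegral.integral_same]

/-- Hölder continuity, global on `[0, ∞)`: integrating the density bound yields a difference of
powers with exponent `H.order r ∈ (0, 1]`, and such powers are subadditive. -/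
lemma exists_powCdf_add_sub_le {r : ℕ} (hr : r ≠ 0) : ∃ D : ℝ, 0 < D ∧ ∀ s h, 0 ≤ s → 0 ≤ h →
    H.powCdf r (s + h) - H.powCdf r s ≤ D * h ^ H.order r := by
  obtain ⟨D, hD0, hD⟩ := H.exists_integral_pdf_le
  refine ⟨D, hD0, fun s h hs hh => ?_⟩
  have hle : s ^ (1 / r : ℝ) ≤ (s + h) ^ (1 / r : ℝ) :=
    Real.rpow_le_rpow hs (by linarith) (by positivity)
  have h0 : 0 ≤ s ^ (1 / r : ℝ) := by positivity
  rw [H.powCdf_eq hr hs, H.powCdf_eq hr (add_nonneg hs hh),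
    intervalIntegral.integral_interval_sub_left
      (H.intervalIntegrable_pdf le_rfl (h0.trans hle)) (H.intervalIntegrable_pdf le_rfl h0)]
  refine (hD _ _ h0 hle).trans ?_
  rw [← Real.rpow_mul hs, ← Real.rpow_mul (add_nonneg hs hh),
    show 1 / (r : ℝ) * H.expo = H.order r by rw [H.order_eq]; ring]
  have := Real.rpow_add_le_add_rpow hs hh (H.order_pos hr).le (H.order_le_one hr)
  gcongr
  linarith

lemma exists_powCdf_le {r : ℕ} (hr : r ≠ 0) : ∃ D : ℝ, 0 < D ∧ ∀ s, 0 ≤ s →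
    H.powCdf r s ≤ D * s ^ H.order r := by
  obtain ⟨D, hD0, hD⟩ := H.exists_powCdf_add_sub_le hr
  refine ⟨D, hD0, fun s hs => ?_⟩
  simpa [H.powCdf_zero hr] using hD 0 s le_rfl hs

/-- The coefficient of `x ^ H.expo` in the small-argument behaviour of the distribution
function. -/
def coeff : ℝ := H.w / H.lam * 0 ^ (1 - H.expo)
  + (1 - H.w) / (H.b ^ (H.a * H.c) * Real.Gamma (H.a + 1)) * 0 ^ (H.a * H.c - H.expo)

/-- The powers of `0` in `coeff` are `1` at exponent zero and `0` at positive exponents: they select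
the components attaining `min 1 (a c)`, both of them when `a c = 1`. At least one always survives.
-/
lemma coeff_pos : 0 < H.coeff := by
  have := H.w_pos; have := H.w_lt_one; have := H.lam_pos; have := H.b_pos; have := H.c_pos
  have := H.a_pos
  have := Real.Gamma_pos_of_pos (add_pos H.a_pos one_pos)
  have : 0 < 1 - H.w := by linarith
  rcases min_cases 1 (H.a * H.c) with h | h
  · have e : H.expo = 1 := h.1
    rw [coeff, e, sub_self, Real.rpow_zero]
    positivity
  · have e : H.expo = H.a * H.c := h.1
    rw [coeff, e, sub_self, Real.rpow_zero]
    positivity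

/-- Squeeze. Without its exponential factors the density integrates exactly to `g x * x ^ expo`; on
`(0, x)` each of those factors lies between `e x` and `1`, and `e x → 1`. -/
lemma tendsto_integral_pdf_div :
    Tendsto (fun x => (∫ y in 0..x, H.pdf y) / x ^ H.expo) (nhdsWithin 0 (Ioi 0))
      (nhds H.coeff) := by
  have := H.w_pos; have := H.w_lt_one; have := H.lam_pos; have := H.b_pos; have := H.c_pos
  have ha := H.a_pos
  have := Real.Gamma_pos_of_pos H.a_pos
  have hw : 0 < 1 - H.w := by linarith
  have hac : 0 < H.a * H.c := by positivity
  set A₂ := (1 - H.w) / (H.b ^ (H.a * H.c) * Real.Gamma (H.a + 1)) with hA₂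
  set g : ℝ → ℝ := fun x => H.w / H.lam * x ^ (1 - H.expo) + A₂ * x ^ (H.a * H.c - H.expo) with hg
  have hgt : Tendsto g (nhdsWithin 0 (Ioi 0)) (nhds H.coeff) := by
    have : ContinuousAt g 0 := by
      refine ContinuousAt.add (continuousAt_const.mul ?_) (continuousAt_const.mul ?_)
      · exact Real.continuousAt_rpow_const _ _ (Or.inr (sub_nonneg.mpr H.expo_le_one))
      · exact Real.continuousAt_rpow_const _ _ (Or.inr (sub_nonneg.mpr H.expo_le_mul))
    exact this.tendsto.mono_left nhdsWithin_le_nhds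
  set e : ℝ → ℝ := fun x => Real.exp (-x / H.lam) * Real.exp (-(x / H.b) ^ H.c) with he
  have het : Tendsto e (nhdsWithin 0 (Ioi 0)) (nhds 1) := by
    have : ContinuousAt e 0 := by
      refine ContinuousAt.mul (by fun_prop) (Real.continuous_exp.continuousAt.comp
        (ContinuousAt.neg (ContinuousAt.rpow_const (by fun_prop) (Or.inr H.c_pos.le))))
    have h0 : e 0 = 1 := by simp [he, Real.zero_rpow H.c_pos.ne']
    rw [← h0]
    exact this.tendsto.mono_left nhdsWithin_le_nhds
  set l : ℝ → ℝ := fun y => H.w / H.lam + A₂ * (H.a * H.c) * y ^ (H.a * H.c - 1) with hl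
  have hpdf : ∀ y, H.pdf y = H.w / H.lam * Real.exp (-y / H.lam)
      + A₂ * (H.a * H.c) * y ^ (H.a * H.c - 1) * Real.exp (-(y / H.b) ^ H.c) := fun y => by
    rw [EGG.pdf, hA₂, Real.Gamma_add_one ha.ne']
    field_simp
  have hA₂pos : 0 < A₂ := by
    have := Real.Gamma_pos_of_pos (add_pos H.a_pos one_pos)
    positivity
  have hr : -1 < H.a * H.c - 1 := by linarith
  have hli : ∀ x, IntervalIntegrable l volume 0 x := fun x =>
    (intervalIntegrable_const).add ((intervalIntegral.intervalIntegrable_rpow' hr).const_mul _)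
  have hlint : ∀ x, 0 < x → (∫ y in 0..x, l y) = g x * x ^ H.expo := fun x hx => by
    rw [intervalIntegral.integral_add intervalIntegrable_const
      ((intervalIntegral.intervalIntegrable_rpow' hr).const_mul _),
      intervalIntegral.integral_const_mul, integral_rpow (Or.inl hr),
      intervalIntegral.integral_const, sub_add_cancel, Real.zero_rpow hac.ne', hg]
    simp only [add_mul, mul_assoc, ← Real.rpow_add hx, sub_add_cancel, Real.rpow_one, smul_eq_mul]
    field_simp
    ring
  have hge : Tendsto (fun x => e x * g x) (nhdsWithin 0 (Ioi 0)) (nhds H.coeff) := by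
    simpa using het.mul hgt
  refine tendsto_of_tendsto_of_tendsto_of_le_of_le' hge hgt ?_ ?_
  · filter_upwards [self_mem_nhdsWithin] with x hx
    have hx : 0 < x := hx
    rw [le_div_iff₀ (by positivity), mul_assoc, ← hlint x hx,
      ← intervalIntegral.integral_const_mul]
    refine intervalIntegral.integral_mono_on_of_le_Ioo hx.le ((hli x).const_mul _)
      (H.intervalIntegrable_pdf le_rfl hx.le) fun y hy => ?_
    have hy0 : 0 < y := hy.1
    have h1 : e x ≤ Real.exp (-y / H.lam) := by
      have a1 : Real.exp (-(x / H.b) ^ H.c) ≤ 1 :=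
        Real.exp_le_one_iff.mpr (neg_nonpos.mpr (by positivity))
      have a2 : Real.exp (-x / H.lam) ≤ Real.exp (-y / H.lam) := by
        gcongr; exact hy.2.le
      calc e x ≤ Real.exp (-x / H.lam) * 1 := by simp only [he]; gcongr
        _ ≤ _ := by rw [mul_one]; exact a2
    have h2 : e x ≤ Real.exp (-(y / H.b) ^ H.c) := by
      have a1 : Real.exp (-x / H.lam) ≤ 1 :=
        Real.exp_le_one_iff.mpr (by rw [neg_div]; exact neg_nonpos.mpr (by positivity))
      have a2 : Real.exp (-(x / H.b) ^ H.c) ≤ Real.exp (-(y / H.b) ^ H.c) := by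
        gcongr; exact hy.2.le
      calc e x ≤ 1 * Real.exp (-(x / H.b) ^ H.c) := by simp only [he]; gcongr
        _ ≤ _ := by rw [one_mul]; exact a2
    rw [hpdf, hl]
    calc e x * (H.w / H.lam + A₂ * (H.a * H.c) * y ^ (H.a * H.c - 1))
        = H.w / H.lam * e x + A₂ * (H.a * H.c) * y ^ (H.a * H.c - 1) * e x := by ring
      _ ≤ _ := by gcongr
  · filter_upwards [self_mem_nhdsWithin] with x hx
    have hx : 0 < x := hx
    rw [div_le_iff₀ (by positivity), ← hlint x hx]
    refine intervalIntegral.integral_mono_on_of_le_Ioo hx.le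
      (H.intervalIntegrable_pdf le_rfl hx.le) (hli x) fun y hy => ?_
    have hy0 : 0 < y := hy.1
    have a1 : Real.exp (-(y / H.b) ^ H.c) ≤ 1 :=
      Real.exp_le_one_iff.mpr (neg_nonpos.mpr (by positivity))
    have a2 : Real.exp (-y / H.lam) ≤ 1 :=
      Real.exp_le_one_iff.mpr (by rw [neg_div]; exact neg_nonpos.mpr (by positivity))
    rw [hpdf, hl]
    refine add_le_add (mul_le_of_le_one_right (by positivity) a2)
      (mul_le_of_le_one_right (by positivity) a1)

lemma tendsto_powCdf_div {r : ℕ} (hr : r ≠ 0) :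
    Tendsto (fun s => H.powCdf r s / s ^ H.order r) (nhdsWithin 0 (Ioi 0)) (nhds H.coeff) := by
  have hr0 : (0 : ℝ) < 1 / r := by positivity
  have h1 : Tendsto (fun s : ℝ => s ^ (1 / r : ℝ)) (nhdsWithin 0 (Ioi 0))
      (nhdsWithin 0 (Ioi 0)) := by
    refine tendsto_nhdsWithin_iff.mpr ⟨?_, ?_⟩
    · have := (Real.continuousAt_rpow_const 0 (1 / r : ℝ) (Or.inr hr0.le)).tendsto
      rw [Real.zero_rpow hr0.ne'] at this
      exact this.mono_left nhdsWithin_le_nhds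
    · filter_upwards [self_mem_nhdsWithin] with s hs
      exact Real.rpow_pos_of_pos hs _
  refine (H.tendsto_integral_pdf_div.comp h1).congr' ?_
  filter_upwards [self_mem_nhdsWithin] with s hs
  have hs : 0 < s := hs
  rw [Function.comp_apply, H.powCdf_eq hr hs.le, ← Real.rpow_mul hs.le,
    show 1 / (r : ℝ) * H.expo = H.order r by rw [H.order_eq]; ring]

end EGG

end UWOC

end

/-! ### Negative moments of the EGG distribution. -/

noncomputable section

namespace UWOC

namespace EGG

variable (H : EGG)

lemma integral_law (h : ℝ → ℝ) : ∫ x, h x ∂H.law = ∫ x in Ioi 0, H.pdf x * h x := by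
  rw [EGG.law, integral_withDensity_eq_integral_toReal_smul
    H.measurable_pdf.ennreal_ofReal (ae_of_all _ fun _ => ENNReal.ofReal_lt_top)]
  refine setIntegral_congr_fun measurableSet_Ioi fun x hx => ?_
  rw [ENNReal.toReal_ofReal (H.pdf_nonneg hx), smul_eq_mul]

lemma integrable_law_iff {h : ℝ → ℝ} :
    Integrable h H.law ↔ IntegrableOn (fun x => H.pdf x * h x) (Ioi 0) := by
  rw [EGG.law, integrable_withDensity_iff_integrable_smul' H.measurable_pdf.ennreal_ofReal
    (ae_of_all _ fun _ => ENNReal.ofReal_lt_top)]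
  refine integrableOn_congr_fun (fun x hx => ?_) measurableSet_Ioi
  rw [ENNReal.toReal_ofReal (H.pdf_nonneg hx), smul_eq_mul]

/-- The value of the moment of order `-σ` of the EGG distribution, for `σ < H.expo`. -/
def negMoment (σ : ℝ) : ℝ := H.w / H.lam ^ σ * Real.Gamma (1 - σ)
  + (1 - H.w) / (Real.Gamma H.a * H.b ^ σ) * Real.Gamma (H.a - σ / H.c)

lemma negMoment_pos {σ : ℝ} (hσ : σ < H.expo) : 0 < H.negMoment σ := by
  have := H.w_pos; have := H.w_lt_one; have := H.lam_pos; have := H.b_pos; have := H.c_pos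
  have := Real.Gamma_pos_of_pos H.a_pos
  have hw : 0 < 1 - H.w := by linarith
  have h1 : 0 < 1 - σ := by linarith [H.expo_le_one]
  have h2 : 0 < H.a - σ / H.c := by
    rw [sub_pos, div_lt_iff₀ H.c_pos]
    linarith [H.expo_le_mul]
  have := Real.Gamma_pos_of_pos h1
  have := Real.Gamma_pos_of_pos h2
  unfold negMoment
  positivity

lemma integrable_rpow_neg_and_integral_eq {σ : ℝ} (hσ : σ < H.expo) :
    Integrable (fun x => x ^ (-σ)) H.law ∧ ∫ x, x ^ (-σ) ∂H.law = H.negMoment σ := by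
  have := H.w_pos; have := H.w_lt_one; have hl := H.lam_pos; have hb := H.b_pos
  have hc := H.c_pos
  have hG := Real.Gamma_pos_of_pos H.a_pos
  have h1 : 0 < (1 : ℝ) + -σ := by linarith [H.expo_le_one]
  have h2 : -1 < H.a * H.c - 1 - σ := by linarith [H.expo_le_mul]
  have i₁ := (integrableOn_gammaWeight h1 (inv_pos.mpr hl)).integrable.const_mul (H.w / H.lam)
  have hbc : 0 < H.b ^ (-H.c) := by positivity
  have i₂ := (integrableOn_rpow_mul_exp_neg_mul_rpow h2 hc hbc).integrable.const_mul
    ((1 - H.w) * (H.c / (H.b ^ (H.a * H.c) * Real.Gamma H.a)))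
  have e : ∀ x ∈ Ioi (0 : ℝ), H.w / H.lam *
        (x ^ ((1 : ℝ) - 1) * Real.exp (-(H.lam⁻¹ * x)) * x ^ (-σ))
      + (1 - H.w) * (H.c / (H.b ^ (H.a * H.c) * Real.Gamma H.a))
        * (x ^ (H.a * H.c - 1 - σ) * Real.exp (-H.b ^ (-H.c) * x ^ H.c))
      = H.pdf x * x ^ (-σ) := fun x hx => by
    have hx : 0 < x := hx
    have e1 : (x / H.b) ^ H.c = H.b ^ (-H.c) * x ^ H.c := by
      rw [Real.div_rpow hx.le hb.le, Real.rpow_neg hb.le]; field_simp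
    rw [EGG.pdf, e1, sub_self, Real.rpow_zero, one_mul, sub_eq_add_neg (H.a * H.c - 1),
      Real.rpow_add hx, show -(H.lam⁻¹ * x) = -x / H.lam by ring,
      show -(H.b ^ (-H.c) * x ^ H.c) = -H.b ^ (-H.c) * x ^ H.c by ring]
    ring
  constructor
  · rw [integrable_law_iff]
    exact IntegrableOn.congr_fun (i₁.add i₂) e measurableSet_Ioi
  · rw [integral_law, ← setIntegral_congr_fun measurableSet_Ioi e, integral_add i₁ i₂,
      integral_const_mul, integral_const_mul, integral_gammaWeight h1 (inv_pos.mpr hl),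
      integral_rpow_mul_exp_neg_mul_rpow hc h2 hbc, negMoment]
    congr 1
    · rw [Real.inv_rpow hl.le, Real.rpow_neg hl.le, inv_inv, Real.rpow_add hl, Real.rpow_one,
        Real.rpow_neg hl.le, ← sub_eq_add_neg]
      field_simp
    · have e1 : (H.b ^ (-H.c)) ^ (-(H.a * H.c - 1 - σ + 1) / H.c)
          = H.b ^ (H.a * H.c) / H.b ^ σ := by
        rw [← Real.rpow_mul hb.le, ← Real.rpow_sub hb]
        congr 1
        field_simp
        ring
      rw [e1, show (H.a * H.c - 1 - σ + 1) / H.c = H.a - σ / H.c by field_simp; ring]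
      field_simp

lemma integral_rpow_neg {σ : ℝ} (hσ : σ < H.expo) :
    ∫ x, x ^ (-σ) ∂H.law = H.negMoment σ := (H.integrable_rpow_neg_and_integral_eq hσ).2

lemma integrable_rpow_neg {σ : ℝ} (hσ : σ < H.expo) :
    Integrable (fun x => x ^ (-σ)) H.law := (H.integrable_rpow_neg_and_integral_eq hσ).1

/-- The constant is uniform in `σ` and the blow-up at the critical exponent is explicit. The case of
equal orders depends on this, because there the exponent varies with the SNRs. -/
lemma exists_integral_rpow_neg_le [IsProbabilityMeasure H.law] : ∃ D : ℝ, 0 < D ∧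
    ∀ σ, 0 ≤ σ → σ < H.expo → ∫ x, x ^ (-σ) ∂H.law ≤ D / (H.expo - σ) := by
  obtain ⟨D, hD0, hD⟩ := H.exists_pdf_le
  refine ⟨1 + D, by positivity, fun σ hσ0 hσ => ?_⟩
  have hd : 0 < H.expo - σ := by linarith
  have hI := H.integrable_rpow_neg hσ
  have hle : ∫ x, x ^ (-σ) ∂H.law
      ≤ ∫ x, (1 + (Ioc (0 : ℝ) 1).indicator (fun x => x ^ (-σ)) x) ∂H.law := by
    refine integral_mono_ae hI ((integrable_const 1).add (hI.indicator measurableSet_Ioc)) ?_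
    filter_upwards [H.law_ae_pos] with x hx
    by_cases h1 : x ≤ 1
    · have : x ∈ Ioc (0 : ℝ) 1 := ⟨hx, h1⟩
      simp only [indicator_of_mem this]
      linarith
    · have : x ∉ Ioc (0 : ℝ) 1 := fun h => h1 h.2
      simp only [indicator_of_notMem this, add_zero]
      exact Real.rpow_le_one_of_one_le_of_nonpos (not_le.mp h1).le (by linarith)
  refine hle.trans ?_
  rw [integral_add (integrable_const 1) (hI.indicator measurableSet_Ioc)]
  have h3 : ∫ x, (Ioc (0 : ℝ) 1).indicator (fun x => x ^ (-σ)) x ∂H.law ≤ D / (H.expo - σ) := by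
    have e : ∀ x, H.pdf x * (Ioc (0 : ℝ) 1).indicator (fun x => x ^ (-σ)) x
        = (Ioc (0 : ℝ) 1).indicator (fun x => H.pdf x * x ^ (-σ)) x := fun x => by
      by_cases hx : x ∈ Ioc (0 : ℝ) 1 <;> simp [hx]
    rw [integral_law]
    simp_rw [e]
    rw [setIntegral_indicator measurableSet_Ioc,
      inter_eq_right.mpr Ioc_subset_Ioi_self]
    have hr : -1 < H.expo - σ - 1 := by linarith
    have hint := (intervalIntegral.intervalIntegrable_rpow' (a := 0) (b := 1) hr).const_mul D
    calc ∫ x in Ioc (0 : ℝ) 1, H.pdf x * x ^ (-σ)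
        ≤ ∫ x in Ioc (0 : ℝ) 1, D * x ^ (H.expo - σ - 1) := by
          refine setIntegral_mono_on ((H.integrable_law_iff.mp hI).mono_set
            (fun x hx => hx.1)) ?_ measurableSet_Ioc fun x hx => ?_
          · rwa [intervalIntegrable_iff_integrableOn_Ioc_of_le zero_le_one] at hint
          · have hx0 : 0 < x := hx.1
            calc H.pdf x * x ^ (-σ) ≤ D * x ^ (H.expo - 1) * x ^ (-σ) := by
                  gcongr; exact hD x hx0
              _ = D * x ^ (H.expo - σ - 1) := by
                  rw [mul_assoc, ← Real.rpow_add hx0]; ring_nf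
      _ = D / (H.expo - σ) := by
          rw [← intervalIntegral.integral_of_le zero_le_one, intervalIntegral.integral_const_mul,
            integral_rpow (Or.inl hr), sub_add_cancel, Real.one_rpow, Real.zero_rpow hd.ne']
          ring
  -- The contribution of `x > 1` is at most `1`; it is absorbed because `expo - σ ≤ 1`.
  have h4 : 1 ≤ 1 / (H.expo - σ) := by
    rw [one_le_div hd]; linarith [H.expo_le_one]
  calc _ ≤ 1 + D / (H.expo - σ) := by simpa using h3
    _ ≤ 1 / (H.expo - σ) + D / (H.expo - σ) := by linarith
    _ = _ := by ring

lemma div_pow_rpow {C y ρ : ℝ} (hC : 0 < C) (hy : 0 < y) (r : ℕ) :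
    (C / y ^ r) ^ ρ = C ^ ρ * y ^ (-(r * ρ)) := by
  rw [Real.div_rpow hC.le (by positivity), ← Real.rpow_natCast, ← Real.rpow_mul hy.le,
    Real.rpow_neg hy.le]
  rfl

lemma mul_lt_expo {r : ℕ} (hr : r ≠ 0) {ρ : ℝ} (hρ : ρ < H.order r) : r * ρ < H.expo := by
  rw [H.order_eq, lt_div_iff₀ (by positivity)] at hρ
  linarith

lemma integrable_div_pow_rpow {r : ℕ} (hr : r ≠ 0) {C ρ : ℝ} (hC : 0 < C) (hρ : ρ < H.order r) :
    Integrable (fun y => (C / y ^ r) ^ ρ) H.law := by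
  refine ((H.integrable_rpow_neg (H.mul_lt_expo hr hρ)).const_mul (C ^ ρ)).congr ?_
  filter_upwards [H.law_ae_pos] with y hy
  rw [div_pow_rpow hC hy]

lemma integral_div_pow_rpow {r : ℕ} (hr : r ≠ 0) {C ρ : ℝ} (hC : 0 < C) (hρ : ρ < H.order r) :
    ∫ y, (C / y ^ r) ^ ρ ∂H.law = C ^ ρ * H.negMoment (r * ρ) := by
  rw [← H.integral_rpow_neg (H.mul_lt_expo hr hρ), ← integral_const_mul]
  refine integral_congr_ae ?_
  filter_upwards [H.law_ae_pos] with y hy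
  rw [div_pow_rpow hC hy]

lemma exists_integral_div_pow_rpow_le [IsProbabilityMeasure H.law] {r : ℕ} (hr : r ≠ 0) {C : ℝ}
    (hC : 0 < C) : ∃ D : ℝ, 0 < D ∧ ∀ ρ, 0 ≤ ρ → ρ < H.order r →
    ∫ y, (C / y ^ r) ^ ρ ∂H.law ≤ D / (H.order r - ρ) := by
  obtain ⟨D, hD0, hD⟩ := H.exists_integral_rpow_neg_le
  have hr0 : (0 : ℝ) < r := by positivity
  refine ⟨max 1 C * (D / r), by positivity, fun ρ hρ0 hρ => ?_⟩
  have hm := H.mul_lt_expo hr hρ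
  rw [H.integral_div_pow_rpow hr hC hρ, ← H.integral_rpow_neg hm]
  have h1 : C ^ ρ ≤ max 1 C := by
    calc C ^ ρ ≤ (max 1 C) ^ ρ := Real.rpow_le_rpow hC.le (le_max_right _ _) hρ0
      _ ≤ (max 1 C) ^ (1 : ℝ) := Real.rpow_le_rpow_of_exponent_le (le_max_left _ _)
          (hρ.le.trans (H.order_le_one hr))
      _ = _ := Real.rpow_one _
  have h2 := hD (r * ρ) (by positivity) hm
  have h3 : D / (H.expo - r * ρ) = D / r / (H.order r - ρ) := by
    rw [H.order_eq, div_div]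
    congr 1
    field_simp
  rw [h3] at h2
  have h0 : 0 ≤ ∫ y, y ^ (-(r * ρ)) ∂H.law := by
    rw [H.integral_rpow_neg hm]; exact (H.negMoment_pos hm).le
  calc _ ≤ max 1 C * (D / r / (H.order r - ρ)) := by gcongr
    _ = _ := by ring

end EGG

end UWOC

end

/-! ### The end-to-end distribution function: one-hop part, product part and remainder. -/

noncomputable section

namespace UWOC

section General

variable {α β : Type*} [MeasurableSpace α] [MeasurableSpace β]

lemma prod_real_eq_integral (μ : Measure α) (ν : Measure β) [IsProbabilityMeasure μ]
    [IsProbabilityMeasure ν] {S : Set (α × β)} (hS : MeasurableSet S) :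
    (μ.prod ν).real S = ∫ x, ν.real {y | (x, y) ∈ S} ∂μ := by
  rw [measureReal_def, Measure.prod_apply hS]
  exact (integral_toReal (measurable_measure_prodMk_left hS).aemeasurable
    (ae_of_all _ fun _ => measure_lt_top _ _)).symm

lemma prod_real_eq_integral_symm (μ : Measure α) (ν : Measure β) [IsProbabilityMeasure μ]
    [IsProbabilityMeasure ν] {S : Set (α × β)} (hS : MeasurableSet S) :
    (μ.prod ν).real S = ∫ y, μ.real {x | (x, y) ∈ S} ∂ν := by
  rw [measureReal_def, Measure.prod_apply_symm hS]
  exact (integral_toReal (measurable_measure_prodMk_right hS).aemeasurable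
    (ae_of_all _ fun _ => measure_lt_top _ _)).symm

/-- Dominated convergence with majorant `D * (h * V ^ a)`. It serves twice: for averaging over the
other hop (`h = 1`) and for averaging against the Gamma weight. -/
lemma tendsto_integral_mul_comp_div (ν : Measure α) {h V : α → ℝ} (hh : AEMeasurable h ν)
    (hVm : AEMeasurable V ν) (hh0 : ∀ᵐ y ∂ν, 0 ≤ h y) (hV0 : ∀ᵐ y ∂ν, 0 < V y) {G : ℝ → ℝ}
    (hG : Measurable G) {D a κ : ℝ} (hG0 : ∀ s, 0 ≤ G s) (hGD : ∀ s, 0 ≤ s → G s ≤ D * s ^ a)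
    (hlim : Tendsto (fun s => G s / s ^ a) (nhdsWithin 0 (Ioi 0)) (nhds κ))
    (hint : Integrable (fun y => h y * V y ^ a) ν) :
    Tendsto (fun s => (∫ y, h y * G (s * V y) ∂ν) / s ^ a) (nhdsWithin 0 (Ioi 0))
      (nhds (κ * ∫ y, h y * V y ^ a ∂ν)) := by
  simp_rw [← integral_div, ← integral_const_mul κ]
  refine tendsto_integral_filter_of_dominated_convergence (fun y => D * (h y * V y ^ a))
    ?_ ?_ (hint.const_mul D) ?_
  · refine Eventually.of_forall fun s => ?_
    exact ((hh.mul (hG.comp_aemeasurable (hVm.const_mul s))).div_const _).aestronglyMeasurable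
  · filter_upwards [self_mem_nhdsWithin] with s hs
    have hs : 0 < s := hs
    filter_upwards [hh0, hV0] with y hy hVy
    rw [Real.norm_of_nonneg (div_nonneg (mul_nonneg hy (hG0 _)) (by positivity)),
      div_le_iff₀ (by positivity)]
    calc h y * G (s * V y) ≤ h y * (D * (s * V y) ^ a) :=
          mul_le_mul_of_nonneg_left (hGD _ (by positivity)) hy
      _ = _ := by rw [Real.mul_rpow hs.le hVy.le]; ring
  · filter_upwards [hV0] with y hVy
    have h1 : Tendsto (fun s : ℝ => s * V y) (nhdsWithin 0 (Ioi 0)) (nhdsWithin 0 (Ioi 0)) := by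
      refine tendsto_nhdsWithin_iff.mpr ⟨?_, ?_⟩
      · have : Tendsto (fun s : ℝ => s * V y) (nhds 0) (nhds (0 * V y)) :=
          tendsto_id.mul_const _
        rw [zero_mul] at this
        exact this.mono_left nhdsWithin_le_nhds
      · filter_upwards [self_mem_nhdsWithin] with s hs
        exact mul_pos hs hVy
    have h2 := ((hlim.comp h1).const_mul (h y * V y ^ a))
    rw [show κ * (h y * V y ^ a) = h y * V y ^ a * κ by ring]
    refine h2.congr' ?_
    filter_upwards [self_mem_nhdsWithin] with s hs
    have hs : 0 < s := hs
    rw [Function.comp_apply, Real.mul_rpow hs.le hVy.le]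
    have := (Real.rpow_pos_of_pos hs a).ne'
    have := (Real.rpow_pos_of_pos hVy a).ne'
    field_simp

end General

lemma tendsto_integral_gammaWeight_div {p q a : ℝ} (hp : 0 < p) (hq : 0 < q) (ha : 0 < a)
    {G : ℝ → ℝ} (hG : Measurable G) {D κ : ℝ} (hG0 : ∀ s, 0 ≤ G s)
    (hGD : ∀ s, 0 ≤ s → G s ≤ D * s ^ a)
    (hlim : Tendsto (fun s => G s / s ^ a) (nhdsWithin 0 (Ioi 0)) (nhds κ)) :
    Tendsto (fun s => (q ^ p * ∫ x in Ioi 0, x ^ (p - 1) * Real.exp (-(q * x)) * G (s * x)) / s ^ a)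
      (nhdsWithin 0 (Ioi 0)) (nhds (κ * (Real.Gamma (p + a) * q ^ (-a)))) := by
  have h := tendsto_integral_mul_comp_div (volume.restrict (Ioi (0 : ℝ)))
    (h := fun x => x ^ (p - 1) * Real.exp (-(q * x))) (V := fun x => x)
    (by fun_prop) (by fun_prop)
    ((ae_restrict_mem measurableSet_Ioi).mono fun x hx => gammaWeight_nonneg hx)
    (ae_restrict_mem measurableSet_Ioi) hG hG0 hGD hlim
    (integrableOn_gammaWeight (add_pos hp ha) hq)
  rw [integral_gammaWeight (add_pos hp ha) hq] at h
  have e : κ * (Real.Gamma (p + a) * q ^ (-a))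
      = q ^ p * (κ * (Real.Gamma (p + a) * q ^ (-(p + a)))) := by
    rw [neg_add, Real.rpow_add hq, Real.rpow_neg hq.le p]
    have := (Real.rpow_pos_of_pos hq p).ne'
    field_simp
  rw [e]
  refine (h.const_mul (q ^ p)).congr fun s => ?_
  rw [mul_div_assoc]

section TwoHops

/-- The probability that `X ^ r₁ Y ^ r₂ ≤ s C`, for independent EGG variables `X` and `Y`, as an
average over `Y`. -/
def prodCdf (H₁ H₂ : EGG) (r₁ r₂ : ℕ) (C s : ℝ) : ℝ :=
  ∫ y, H₁.powCdf r₁ (s * (C / y ^ r₂)) ∂H₂.law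

lemma prodCdf_nonneg (H₁ H₂ : EGG) (r₁ r₂ : ℕ) (C s : ℝ) : 0 ≤ prodCdf H₁ H₂ r₁ r₂ C s :=
  integral_nonneg fun _ => H₁.powCdf_nonneg _ _

variable (H₁ H₂ : EGG) [IsProbabilityMeasure H₁.law] [IsProbabilityMeasure H₂.law]
  {r₁ r₂ : ℕ} {C : ℝ}

lemma measurable_endSNR (μ₁ μ₂ : ℝ) :
    Measurable fun z : ℝ × ℝ => endSNR r₁ r₂ C μ₁ μ₂ z.1 z.2 := by
  unfold endSNR hopSNR
  fun_prop

/-- For a fixed second irradiance the threshold on `t ^ r₁` is a sum: the first summand belongs to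
hop 1 alone, the second to the product of the hops. -/
lemma endSNR_le_iff (hC : 0 < C) {μ₁ μ₂ : ℝ} (hμ₁ : 0 < μ₁) (hμ₂ : 0 < μ₂) {y : ℝ} (hy : 0 < y)
    (t x : ℝ) : endSNR r₁ r₂ C μ₁ μ₂ t y ≤ x
      ↔ t ^ r₁ ≤ x * μ₁⁻¹ + x * (μ₁ * μ₂)⁻¹ * (C / y ^ r₂) := by
  have hy' : 0 < y ^ r₂ := by positivity
  unfold endSNR hopSNR
  rw [div_le_iff₀ (by positivity)]
  have e : x * μ₁⁻¹ + x * (μ₁ * μ₂)⁻¹ * (C / y ^ r₂)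
      = x * (μ₂ * y ^ r₂ + C) / (μ₁ * (μ₂ * y ^ r₂)) := by
    field_simp
  rw [e, le_div_iff₀ (by positivity)]
  constructor <;> intro h <;> linarith

lemma cdfOf_endSNR {Ω : Type*} [MeasurableSpace Ω] (P : Measure Ω) [IsProbabilityMeasure P]
    {I₁ I₂ : Ω → ℝ} (hI₁ : HasLaw I₁ H₁.law P) (hI₂ : HasLaw I₂ H₂.law P) (hI : IndepFun I₁ I₂ P)
    (hC : 0 < C) {μ₁ μ₂ : ℝ} (hμ₁ : 0 < μ₁) (hμ₂ : 0 < μ₂) (x : ℝ) :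
    cdfOf P (fun o => endSNR r₁ r₂ C μ₁ μ₂ (I₁ o) (I₂ o)) x
      = ∫ y, H₁.powCdf r₁ (x * μ₁⁻¹ + x * (μ₁ * μ₂)⁻¹ * (C / y ^ r₂)) ∂H₂.law := by
  have hS : MeasurableSet {z : ℝ × ℝ | endSNR r₁ r₂ C μ₁ μ₂ z.1 z.2 ≤ x} :=
    measurable_endSNR μ₁ μ₂ measurableSet_Iic
  have h := ((indepFun_iff_hasLaw_prodMk_prod hI₁ hI₂).mp hI).measureReal_eq hS
  rw [cdfOf, h, prod_real_eq_integral_symm _ _ hS]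
  refine integral_congr_ae ?_
  filter_upwards [H₂.law_ae_pos] with y hy
  simp only [EGG.powCdf, endSNR_le_iff hC hμ₁ hμ₂ hy]

/-- Both sides are the probability of one event on the product space. Conditioning can thus be on
the hop of larger order, whose negative moment at the smaller order is finite. -/
lemma prodCdf_comm (s : ℝ) : prodCdf H₁ H₂ r₁ r₂ C s = prodCdf H₂ H₁ r₂ r₁ C s := by
  have hS : MeasurableSet {z : ℝ × ℝ | z.1 ^ r₁ * z.2 ^ r₂ ≤ s * C} :=
    measurableSet_le (by fun_prop) (by fun_prop)
  have h1 := prod_real_eq_integral H₁.law H₂.law hS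
  have h2 := prod_real_eq_integral_symm H₁.law H₂.law hS
  have e1 : prodCdf H₁ H₂ r₁ r₂ C s = (H₁.law.prod H₂.law).real
      {z : ℝ × ℝ | z.1 ^ r₁ * z.2 ^ r₂ ≤ s * C} := by
    rw [h2, prodCdf]
    refine integral_congr_ae ?_
    filter_upwards [H₂.law_ae_pos] with y hy
    simp only [EGG.powCdf]
    congr 1
    ext x
    have : 0 < y ^ r₂ := by positivity
    simp only [mem_ofPred_eq]
    rw [← mul_div_assoc, le_div_iff₀ this]
  have e2 : prodCdf H₂ H₁ r₂ r₁ C s = (H₁.law.prod H₂.law).real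
      {z : ℝ × ℝ | z.1 ^ r₁ * z.2 ^ r₂ ≤ s * C} := by
    rw [h1, prodCdf]
    refine integral_congr_ae ?_
    filter_upwards [H₁.law_ae_pos] with x hx
    simp only [EGG.powCdf]
    congr 1
    ext y
    have : 0 < x ^ r₁ := by positivity
    simp only [mem_ofPred_eq]
    rw [← mul_div_assoc, le_div_iff₀ this, mul_comm]
  rw [e1, e2]

lemma EGG.measurable_powCdf (r : ℕ) : Measurable (H₁.powCdf r) := (H₁.powCdf_mono r).measurable

lemma integrable_powCdf_comp {f : ℝ → ℝ} (hf : Measurable f) :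
    Integrable (fun y => H₁.powCdf r₁ (f y)) H₂.law := by
  refine Integrable.mono' (integrable_const (1 : ℝ))
    ((H₁.measurable_powCdf r₁).comp hf).aestronglyMeasurable (ae_of_all _ fun y => ?_)
  rw [Real.norm_of_nonneg (H₁.powCdf_nonneg _ _)]
  exact H₁.powCdf_le_one _ _

lemma prodCdf_le_one (s : ℝ) : prodCdf H₁ H₂ r₁ r₂ C s ≤ 1 := by
  calc prodCdf H₁ H₂ r₁ r₂ C s ≤ ∫ _, (1 : ℝ) ∂H₂.law :=
        integral_mono (integrable_powCdf_comp H₁ H₂ (by fun_prop)) (integrable_const _)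
          fun y => H₁.powCdf_le_one _ _
    _ = 1 := by simp

lemma measurable_prodCdf (hC : 0 < C) : Measurable (prodCdf H₁ H₂ r₁ r₂ C) := by
  refine Monotone.measurable fun s t hst => ?_
  refine integral_mono_ae (integrable_powCdf_comp H₁ H₂ (by fun_prop))
    (integrable_powCdf_comp H₁ H₂ (by fun_prop)) ?_
  filter_upwards [H₂.law_ae_pos] with y hy
  refine H₁.powCdf_mono _ ?_
  gcongr

/-- A distribution function that is `O(v ^ α)` and at most `1` is `O(v ^ ρ)` on all of `[0, ∞)` for
every `ρ ∈ [0, α]`, with one constant; averaging `v = s C / Y ^ r₂` costs a negative moment. The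
exponent `ρ` stays free for later optimization. -/
lemma exists_prodCdf_le (hr₁ : r₁ ≠ 0) (hr₂ : r₂ ≠ 0) (hC : 0 < C) : ∃ D : ℝ, 0 < D ∧
    ∀ ρ s, 0 ≤ ρ → ρ ≤ H₁.order r₁ → ρ < H₂.order r₂ → 0 ≤ s →
      prodCdf H₁ H₂ r₁ r₂ C s ≤ D / (H₂.order r₂ - ρ) * s ^ ρ := by
  obtain ⟨D₁, hD₁, h₁⟩ := H₁.exists_powCdf_le hr₁
  obtain ⟨D₂, hD₂, h₂⟩ := H₂.exists_integral_div_pow_rpow_le hr₂ hC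
  refine ⟨max D₁ 1 * D₂, by positivity, fun ρ s hρ0 hρ₁ hρ₂ hs => ?_⟩
  have key : ∀ v, 0 ≤ v → H₁.powCdf r₁ v ≤ max D₁ 1 * v ^ ρ := fun v hv => by
    rcases le_total v 1 with hv1 | hv1
    · calc _ ≤ D₁ * v ^ H₁.order r₁ := h₁ v hv
        _ ≤ max D₁ 1 * v ^ ρ := by
          gcongr ?_ * ?_
          · exact le_max_left _ _
          · exact Real.rpow_le_rpow_of_exponent_ge_of_imp hv hv1 hρ₁
              (fun _ h => absurd h (H₁.order_pos hr₁).ne')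
    · calc _ ≤ (1 : ℝ) := H₁.powCdf_le_one _ _
        _ = 1 * 1 := (one_mul 1).symm
        _ ≤ max D₁ 1 * v ^ ρ := by
          gcongr
          · exact le_max_right _ _
          · exact Real.one_le_rpow hv1 hρ0
  calc prodCdf H₁ H₂ r₁ r₂ C s ≤ ∫ y, max D₁ 1 * s ^ ρ * (C / y ^ r₂) ^ ρ ∂H₂.law := by
        refine integral_mono_ae (integrable_powCdf_comp H₁ H₂ (by fun_prop))
          ((H₂.integrable_div_pow_rpow hr₂ hC hρ₂).const_mul _) ?_
        filter_upwards [H₂.law_ae_pos] with y hy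
        have : 0 ≤ C / y ^ r₂ := by positivity
        refine (key _ (by positivity)).trans_eq ?_
        rw [Real.mul_rpow hs this]
        ring
    _ ≤ max D₁ 1 * s ^ ρ * (D₂ / (H₂.order r₂ - ρ)) := by
        rw [integral_const_mul]
        gcongr
        exact h₂ ρ hρ0 hρ₂
    _ = _ := by ring

lemma exists_prodCdf_le_of_order_lt (hr₁ : r₁ ≠ 0) (hr₂ : r₂ ≠ 0) (hC : 0 < C)
    (h : H₂.order r₂ < H₁.order r₁) : ∃ D : ℝ, 0 < D ∧ ∀ s, 0 ≤ s →
      prodCdf H₁ H₂ r₁ r₂ C s ≤ D * s ^ H₂.order r₂ := by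
  obtain ⟨D, hD, h1⟩ := exists_prodCdf_le H₂ H₁ hr₂ hr₁ hC
  refine ⟨D / (H₁.order r₁ - H₂.order r₂), div_pos hD (sub_pos.mpr h), fun s hs => ?_⟩
  rw [prodCdf_comm]
  exact h1 _ s (H₂.order_pos hr₂).le le_rfl h hs

lemma tendsto_prodCdf_div (hr₁ : r₁ ≠ 0) (hr₂ : r₂ ≠ 0) (hC : 0 < C)
    (h : H₂.order r₂ < H₁.order r₁) :
    Tendsto (fun s => prodCdf H₁ H₂ r₁ r₂ C s / s ^ H₂.order r₂) (nhdsWithin 0 (Ioi 0))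
      (nhds (H₂.coeff * (C ^ H₂.order r₂ * H₁.negMoment (r₁ * H₂.order r₂)))) := by
  obtain ⟨D, hD, h1⟩ := H₂.exists_powCdf_le hr₂
  have hlim := tendsto_integral_mul_comp_div H₁.law (h := fun _ => 1) (V := fun x => C / x ^ r₁)
    (by fun_prop) (by fun_prop) (ae_of_all _ fun _ => zero_le_one)
    (H₁.law_ae_pos.mono fun x hx => by positivity) (H₂.measurable_powCdf r₂)
    (H₂.powCdf_nonneg r₂) h1 (H₂.tendsto_powCdf_div hr₂)
    (by simpa using H₁.integrable_div_pow_rpow hr₁ hC h)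
  simp only [one_mul] at hlim
  rw [H₁.integral_div_pow_rpow hr₁ hC h] at hlim
  refine hlim.congr fun s => ?_
  rw [prodCdf_comm, prodCdf]

/-- The quantity `E [min 1 ((C / (Y ^ r μ)) ^ a)]`, `Y` having the EGG distribution. -/
def truncMoment (H : EGG) (r : ℕ) (C a μ : ℝ) : ℝ :=
  ∫ y, min 1 ((C / y ^ r * μ⁻¹) ^ a) ∂H.law

/-- The truncation at `1` is itself the majorant, so no negative moment has to be finite and no
relation between the two orders is required. -/
lemma tendsto_truncMoment (r : ℕ) {a : ℝ} (ha : 0 < a) (hC : 0 < C) :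
    Tendsto (truncMoment H₂ r C a) atTop (nhds 0) := by
  have h0 : (0 : ℝ) = ∫ _, (0 : ℝ) ∂H₂.law := by simp
  rw [h0]
  refine tendsto_integral_filter_of_dominated_convergence (fun _ => 1) ?_ ?_
    (integrable_const _) ?_
  · exact Eventually.of_forall fun μ => Measurable.aestronglyMeasurable (by fun_prop)
  · filter_upwards [eventually_gt_atTop 0] with μ hμ
    filter_upwards [H₂.law_ae_pos] with y hy
    rw [Real.norm_of_nonneg (le_min zero_le_one (by positivity))]
    exact min_le_left _ _
  · filter_upwards [H₂.law_ae_pos] with y hy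
    have h1 : Tendsto (fun μ : ℝ => (C / y ^ r * μ⁻¹) ^ a) atTop (nhds 0) := by
      have h2 : Tendsto (fun μ : ℝ => C / y ^ r * μ⁻¹) atTop (nhds 0) := by
        simpa using (tendsto_inv_atTop_zero (𝕜 := ℝ)).const_mul (C / y ^ r)
      simpa [Real.zero_rpow ha.ne'] using h2.rpow_const (p := a) (Or.inr ha.le)
    have h3 := (tendsto_const_nhds (x := (1 : ℝ))).min h1
    simpa using h3

lemma exists_abs_integral_powCdf_sub_le (hr₁ : r₁ ≠ 0) (hC : 0 < C) :
    ∃ D : ℝ, 0 < D ∧ ∀ μ₁ μ₂ x, 0 < μ₁ → 0 < μ₂ → 0 ≤ x →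
      |(∫ y, H₁.powCdf r₁ (x * μ₁⁻¹ + x * (μ₁ * μ₂)⁻¹ * (C / y ^ r₂)) ∂H₂.law)
        - H₁.powCdf r₁ (μ₁⁻¹ * x) - prodCdf H₁ H₂ r₁ r₂ C ((μ₁ * μ₂)⁻¹ * x)|
      ≤ D * (μ₁⁻¹ * x) ^ H₁.order r₁ * truncMoment H₂ r₂ C (H₁.order r₁) μ₂ := by
  obtain ⟨D, hD0, hD⟩ := H₁.exists_powCdf_add_sub_le hr₁
  refine ⟨D, hD0, fun μ₁ μ₂ x hμ₁ hμ₂ hx => ?_⟩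
  set α := H₁.order r₁
  -- Both the increment from `u` to `u + v` and the value at `v` lie in `[0, D * v ^ α]`, hence so
  -- does the absolute value of their difference.
  have key : ∀ u v, 0 ≤ u → 0 ≤ v →
      |H₁.powCdf r₁ (u + v) - H₁.powCdf r₁ u - H₁.powCdf r₁ v| ≤ D * v ^ α := by
    intro u v hu hv
    have h1 := hD u v hu hv
    have h2 := hD 0 v le_rfl hv
    rw [zero_add, H₁.powCdf_zero hr₁, sub_zero] at h2
    have h3 := H₁.powCdf_mono r₁ (le_add_of_nonneg_right hv : u ≤ u + v)
    have h4 := H₁.powCdf_nonneg r₁ v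
    rw [abs_le]
    constructor <;> linarith
  have i1 : Integrable (fun y => H₁.powCdf r₁ (x * μ₁⁻¹ + x * (μ₁ * μ₂)⁻¹ * (C / y ^ r₂)))
      H₂.law := integrable_powCdf_comp H₁ H₂ (by fun_prop)
  have i2 : Integrable (fun y => H₁.powCdf r₁ ((μ₁ * μ₂)⁻¹ * x * (C / y ^ r₂))) H₂.law :=
    integrable_powCdf_comp H₁ H₂ (by fun_prop)
  have i3 : Integrable (fun _ : ℝ => H₁.powCdf r₁ (μ₁⁻¹ * x)) H₂.law := integrable_const _
  have e : (∫ y, H₁.powCdf r₁ (x * μ₁⁻¹ + x * (μ₁ * μ₂)⁻¹ * (C / y ^ r₂)) ∂H₂.law)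
        - H₁.powCdf r₁ (μ₁⁻¹ * x) - prodCdf H₁ H₂ r₁ r₂ C ((μ₁ * μ₂)⁻¹ * x)
      = ∫ y, (H₁.powCdf r₁ (x * μ₁⁻¹ + x * (μ₁ * μ₂)⁻¹ * (C / y ^ r₂))
        - H₁.powCdf r₁ (μ₁⁻¹ * x) - H₁.powCdf r₁ ((μ₁ * μ₂)⁻¹ * x * (C / y ^ r₂))) ∂H₂.law := by
    have i4 : Integrable (fun y => H₁.powCdf r₁ (x * μ₁⁻¹ + x * (μ₁ * μ₂)⁻¹ * (C / y ^ r₂))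
        - H₁.powCdf r₁ (μ₁⁻¹ * x)) H₂.law := i1.sub i3
    rw [integral_sub i4 i2, integral_sub i1 i3, prodCdf]
    simp
  rw [e, truncMoment, ← integral_const_mul]
  refine (abs_integral_le_integral_abs).trans (integral_mono_ae (((i1.sub i3).sub i2).abs) ?_ ?_)
  · refine Integrable.const_mul ?_ _
    refine Integrable.mono' (integrable_const (1 : ℝ)) (Measurable.aestronglyMeasurable
      (by fun_prop)) ?_
    filter_upwards [H₂.law_ae_pos] with y hy
    rw [Real.norm_of_nonneg (le_min zero_le_one (by positivity))]
    exact min_le_left _ _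
  · filter_upwards [H₂.law_ae_pos] with y hy
    set u := μ₁⁻¹ * x with hu
    set z := C / y ^ r₂ * μ₂⁻¹ with hz
    have hz0 : 0 ≤ z := by positivity
    have hu0 : 0 ≤ u := by positivity
    have e1 : x * (μ₁ * μ₂)⁻¹ * (C / y ^ r₂) = u * z := by
      rw [hu, hz]; field_simp
    have e2 : (μ₁ * μ₂)⁻¹ * x * (C / y ^ r₂) = u * z := by
      rw [hu, hz]; field_simp
    rw [e1, e2, show x * μ₁⁻¹ = u by rw [hu]; ring, mul_min_of_nonneg _ _ (by positivity)]
    -- The expression is symmetric in its two arguments: `key` with the roles exchanged gives `D * u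
    -- ^ α`, and directly gives `D * (u * z) ^ α`.
    refine le_min ?_ ?_
    · have := key (u * z) u (by positivity) hu0
      rw [mul_one]
      convert! this using 2
      rw [add_comm]; ring
    · refine (key u (u * z) hu0 (by positivity)).trans_eq ?_
      rw [Real.mul_rpow hu0 hz0]; ring

end TwoHops

end UWOC

end

/-! ### Transfer of the estimates to the BER summands. -/

noncomputable section

namespace UWOC

lemma integrableOn_gammaWeight_mul {p q : ℝ} (hp : 0 < p) (hq : 0 < q) {G : ℝ → ℝ}
    (hG : Measurable G) (hG0 : ∀ x, 0 ≤ G x) (hG1 : ∀ x, G x ≤ 1) :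
    IntegrableOn (fun x => x ^ (p - 1) * Real.exp (-(q * x)) * G x) (Ioi 0) := by
  refine Integrable.mono' (integrableOn_gammaWeight_zero hp hq)
    (Measurable.aestronglyMeasurable (by fun_prop)) ?_
  filter_upwards [ae_restrict_mem measurableSet_Ioi] with x hx
  have hw := gammaWeight_nonneg (p := p) (q := q) hx
  rw [Real.norm_of_nonneg (mul_nonneg hw (hG0 x))]
  exact mul_le_of_le_one_right hw (hG1 x)

lemma exists_integral_gammaWeight_le {p q a : ℝ} (hp : 0 < p) (hq : 0 < q) (ha : 0 ≤ a) :
    ∃ D : ℝ, 0 < D ∧ ∀ ρ, 0 ≤ ρ → ρ ≤ a →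
      ∫ x in Ioi (0 : ℝ), x ^ (p - 1) * Real.exp (-(q * x)) * x ^ ρ ≤ D := by
  have i0 := integrableOn_gammaWeight_zero hp hq
  have i1 := integrableOn_gammaWeight (add_pos_of_pos_of_nonneg hp ha) hq
  refine ⟨max 1 (∫ x in Ioi (0 : ℝ), (x ^ (p - 1) * Real.exp (-(q * x))
    + x ^ (p - 1) * Real.exp (-(q * x)) * x ^ a)), by positivity, fun ρ hρ hρa => ?_⟩
  refine le_trans ?_ (le_max_right _ _)
  refine setIntegral_mono_on (integrableOn_gammaWeight (add_pos_of_pos_of_nonneg hp hρ) hq)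
    (i0.add i1) measurableSet_Ioi fun x hx => ?_
  have hx : 0 < x := hx
  have hw := gammaWeight_nonneg (p := p) (q := q) hx
  -- This majorant does not involve `ρ`, which makes the final constant uniform.
  have h : x ^ ρ ≤ 1 + x ^ a := by
    rcases le_total x 1 with h1 | h1
    · linarith [Real.rpow_le_one hx.le h1 hρ, Real.rpow_nonneg hx.le a]
    · linarith [Real.rpow_le_rpow_of_exponent_le h1 hρa]
  calc _ ≤ x ^ (p - 1) * Real.exp (-(q * x)) * (1 + x ^ a) := by gcongr
    _ = _ := by ring

section TwoHops

variable (H₁ H₂ : EGG) [IsProbabilityMeasure H₁.law] [IsProbabilityMeasure H₂.law]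
  {r₁ r₂ : ℕ} {C p q : ℝ}

/-- The contribution of `q = M.q k` to the sum in the average BER. -/
def berSummand (H₁ H₂ : EGG) (r₁ r₂ : ℕ) (C p q μ₁ μ₂ : ℝ) : ℝ :=
  q ^ p * ∫ x in Ioi 0, x ^ (p - 1) * Real.exp (-(q * x))
    * ∫ y, H₁.powCdf r₁ (x * μ₁⁻¹ + x * (μ₁ * μ₂)⁻¹ * (C / y ^ r₂)) ∂H₂.law

/-- The summand of the average BER when the SNR is `s⁻¹ X ^ r`. -/
def hopBER (H : EGG) (r : ℕ) (p q s : ℝ) : ℝ :=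
  q ^ p * ∫ x in Ioi 0, x ^ (p - 1) * Real.exp (-(q * x)) * H.powCdf r (s * x)

/-- The summand of the average BER when the SNR is `X ^ r₁ Y ^ r₂ / (s C)`. -/
def prodBER (H₁ H₂ : EGG) (r₁ r₂ : ℕ) (C p q s : ℝ) : ℝ :=
  q ^ p * ∫ x in Ioi 0, x ^ (p - 1) * Real.exp (-(q * x)) * prodCdf H₁ H₂ r₁ r₂ C (s * x)

lemma exists_abs_berSummand_sub_le (hr₁ : r₁ ≠ 0) (hC : 0 < C) (hp : 0 < p) (hq : 0 < q) :
    ∃ D : ℝ, 0 < D ∧ ∀ μ₁ μ₂, 0 < μ₁ → 0 < μ₂ →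
      |berSummand H₁ H₂ r₁ r₂ C p q μ₁ μ₂ - hopBER H₁ r₁ p q μ₁⁻¹
        - prodBER H₁ H₂ r₁ r₂ C p q (μ₁ * μ₂)⁻¹|
      ≤ D * μ₁⁻¹ ^ H₁.order r₁ * truncMoment H₂ r₂ C (H₁.order r₁) μ₂ := by
  obtain ⟨D, hD0, hD⟩ := exists_abs_integral_powCdf_sub_le H₁ H₂ (r₂ := r₂) hr₁ hC
  have hα := H₁.order_pos hr₁
  set α := H₁.order r₁ with hαdef
  have hI := integrableOn_gammaWeight (s := α) (add_pos hp hα) hq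
  have hI0 : 0 ≤ ∫ x in Ioi (0 : ℝ), x ^ (p - 1) * Real.exp (-(q * x)) * x ^ α :=
    setIntegral_nonneg measurableSet_Ioi fun x hx =>
      mul_nonneg (gammaWeight_nonneg hx) (Real.rpow_nonneg (le_of_lt hx) _)
  refine ⟨q ^ p * (D * (1 + ∫ x in Ioi (0 : ℝ), x ^ (p - 1) * Real.exp (-(q * x)) * x ^ α)),
    by positivity, fun μ₁ μ₂ hμ₁ hμ₂ => ?_⟩
  set T := truncMoment H₂ r₂ C α μ₂ with hT
  have hT0 : 0 ≤ T := by
    refine integral_nonneg_of_ae ?_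
    filter_upwards [H₂.law_ae_pos] with y hy
    exact le_min zero_le_one (by positivity)
  set F : ℝ → ℝ := fun x => ∫ y, H₁.powCdf r₁ (x * μ₁⁻¹ + x * (μ₁ * μ₂)⁻¹ * (C / y ^ r₂)) ∂H₂.law
    with hF
  have hFm : Measurable F := by
    refine Monotone.measurable fun s t hst => ?_
    refine integral_mono_ae (integrable_powCdf_comp H₁ H₂ (by fun_prop))
      (integrable_powCdf_comp H₁ H₂ (by fun_prop)) ?_
    filter_upwards [H₂.law_ae_pos] with y hy
    refine H₁.powCdf_mono _ ?_
    gcongr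
  have hF0 : ∀ x, 0 ≤ F x := fun x => integral_nonneg fun _ => H₁.powCdf_nonneg _ _
  have hF1 : ∀ x, F x ≤ 1 := fun x => by
    calc F x ≤ ∫ _, (1 : ℝ) ∂H₂.law :=
          integral_mono (integrable_powCdf_comp H₁ H₂ (by fun_prop)) (integrable_const _)
            fun y => H₁.powCdf_le_one _ _
      _ = 1 := by simp
  have iF := integrableOn_gammaWeight_mul hp hq hFm hF0 hF1
  have iH := integrableOn_gammaWeight_mul hp hq (G := fun x => H₁.powCdf r₁ (μ₁⁻¹ * x))
    ((H₁.measurable_powCdf r₁).comp (measurable_const_mul _)) (fun x => H₁.powCdf_nonneg _ _)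
    (fun x => H₁.powCdf_le_one _ _)
  have iP := integrableOn_gammaWeight_mul hp hq
    (G := fun x => prodCdf H₁ H₂ r₁ r₂ C ((μ₁ * μ₂)⁻¹ * x))
    ((measurable_prodCdf H₁ H₂ hC).comp (measurable_const_mul _))
    (fun x => prodCdf_nonneg H₁ H₂ _ _ _ _) (fun x => prodCdf_le_one H₁ H₂ _)
  have iFH : IntegrableOn (fun x => x ^ (p - 1) * Real.exp (-(q * x)) * F x
      - x ^ (p - 1) * Real.exp (-(q * x)) * H₁.powCdf r₁ (μ₁⁻¹ * x)) (Ioi 0) := iF.sub iH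
  have e : berSummand H₁ H₂ r₁ r₂ C p q μ₁ μ₂ - hopBER H₁ r₁ p q μ₁⁻¹
        - prodBER H₁ H₂ r₁ r₂ C p q (μ₁ * μ₂)⁻¹
      = q ^ p * ∫ x in Ioi 0, (x ^ (p - 1) * Real.exp (-(q * x)) * F x
        - x ^ (p - 1) * Real.exp (-(q * x)) * H₁.powCdf r₁ (μ₁⁻¹ * x)
        - x ^ (p - 1) * Real.exp (-(q * x)) * prodCdf H₁ H₂ r₁ r₂ C ((μ₁ * μ₂)⁻¹ * x)) := by
    rw [integral_sub iFH iP, integral_sub iF iH, berSummand, hopBER, prodBER]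
    ring
  rw [e, abs_mul, abs_of_nonneg (by positivity : 0 ≤ q ^ p)]
  have hb : |∫ x in Ioi 0, (x ^ (p - 1) * Real.exp (-(q * x)) * F x
        - x ^ (p - 1) * Real.exp (-(q * x)) * H₁.powCdf r₁ (μ₁⁻¹ * x)
        - x ^ (p - 1) * Real.exp (-(q * x)) * prodCdf H₁ H₂ r₁ r₂ C ((μ₁ * μ₂)⁻¹ * x))|
      ≤ ∫ x in Ioi (0 : ℝ), D * μ₁⁻¹ ^ α * T * (x ^ (p - 1) * Real.exp (-(q * x)) * x ^ α) := by
    refine abs_integral_le_integral_abs.trans ?_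
    refine setIntegral_mono_on (iFH.sub iP).abs (hI.const_mul _) measurableSet_Ioi fun x hx => ?_
    have hx : 0 < x := hx
    have hw := gammaWeight_nonneg (p := p) (q := q) hx
    rw [← mul_sub, ← mul_sub, abs_mul, abs_of_nonneg hw]
    calc _ ≤ x ^ (p - 1) * Real.exp (-(q * x)) * (D * (μ₁⁻¹ * x) ^ α * T) :=
          mul_le_mul_of_nonneg_left (hD μ₁ μ₂ x hμ₁ hμ₂ hx.le) hw
      _ = _ := by rw [Real.mul_rpow (by positivity) hx.le]; ring
  rw [integral_const_mul] at hb
  calc _ ≤ q ^ p * (D * μ₁⁻¹ ^ α * T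
        * ∫ x in Ioi (0 : ℝ), x ^ (p - 1) * Real.exp (-(q * x)) * x ^ α) := by gcongr
    _ ≤ q ^ p * (D * μ₁⁻¹ ^ α * T
        * (1 + ∫ x in Ioi (0 : ℝ), x ^ (p - 1) * Real.exp (-(q * x)) * x ^ α)) := by
          gcongr; linarith
    _ = _ := by ring

lemma exists_prodBER_le (hr₁ : r₁ ≠ 0) (hr₂ : r₂ ≠ 0) (hC : 0 < C) (hp : 0 < p) (hq : 0 < q) :
    ∃ D : ℝ, 0 < D ∧ ∀ ρ s, 0 ≤ ρ → ρ ≤ H₁.order r₁ → ρ < H₂.order r₂ → 0 ≤ s →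
      prodBER H₁ H₂ r₁ r₂ C p q s ≤ D / (H₂.order r₂ - ρ) * s ^ ρ := by
  obtain ⟨D₁, hD₁, h₁⟩ := exists_prodCdf_le H₁ H₂ hr₁ hr₂ hC
  obtain ⟨D₂, hD₂, h₂⟩ := exists_integral_gammaWeight_le hp hq (H₁.order_pos hr₁).le
  refine ⟨q ^ p * (D₁ * D₂), by positivity, fun ρ s hρ hρ₁ hρ₂ hs => ?_⟩
  have hd : 0 < H₂.order r₂ - ρ := sub_pos.mpr hρ₂
  have iP := integrableOn_gammaWeight_mul hp hq
    (G := fun x => prodCdf H₁ H₂ r₁ r₂ C (s * x))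
    ((measurable_prodCdf H₁ H₂ hC).comp (measurable_const_mul _))
    (fun x => prodCdf_nonneg H₁ H₂ _ _ _ _) (fun x => prodCdf_le_one H₁ H₂ _)
  have hb : ∫ x in Ioi 0, x ^ (p - 1) * Real.exp (-(q * x)) * prodCdf H₁ H₂ r₁ r₂ C (s * x)
      ≤ ∫ x in Ioi (0 : ℝ), D₁ / (H₂.order r₂ - ρ) * s ^ ρ
        * (x ^ (p - 1) * Real.exp (-(q * x)) * x ^ ρ) := by
    refine setIntegral_mono_on iP ((integrableOn_gammaWeight
      (add_pos_of_pos_of_nonneg hp hρ) hq).const_mul _) measurableSet_Ioi fun x hx => ?_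
    have hx : 0 < x := hx
    have hw := gammaWeight_nonneg (p := p) (q := q) hx
    calc _ ≤ x ^ (p - 1) * Real.exp (-(q * x)) * (D₁ / (H₂.order r₂ - ρ) * (s * x) ^ ρ) :=
          mul_le_mul_of_nonneg_left (h₁ ρ _ hρ hρ₁ hρ₂ (by positivity)) hw
      _ = _ := by rw [Real.mul_rpow hs hx.le]; ring
  rw [integral_const_mul] at hb
  rw [prodBER]
  calc _ ≤ q ^ p * (D₁ / (H₂.order r₂ - ρ) * s ^ ρ * D₂) := by
        gcongr
        exact hb.trans (mul_le_mul_of_nonneg_left (h₂ ρ hρ hρ₁) (by positivity))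
    _ = _ := by ring

lemma prodBER_nonneg (H₁ H₂ : EGG) (r₁ r₂ : ℕ) (C p : ℝ) {q : ℝ} (hq : 0 < q) (s : ℝ) :
    0 ≤ prodBER H₁ H₂ r₁ r₂ C p q s :=
  mul_nonneg (by positivity) (setIntegral_nonneg measurableSet_Ioi fun _ hx =>
    mul_nonneg (gammaWeight_nonneg hx) (prodCdf_nonneg _ _ _ _ _ _))

lemma tendsto_hopBER_div (hr₁ : r₁ ≠ 0) (hp : 0 < p) (hq : 0 < q) :
    Tendsto (fun s => hopBER H₁ r₁ p q s / s ^ H₁.order r₁) (nhdsWithin 0 (Ioi 0))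
      (nhds (H₁.coeff * (Real.Gamma (p + H₁.order r₁) * q ^ (-H₁.order r₁)))) := by
  obtain ⟨D, hD0, hD⟩ := H₁.exists_powCdf_le hr₁
  exact tendsto_integral_gammaWeight_div hp hq (H₁.order_pos hr₁) (H₁.measurable_powCdf r₁)
    (H₁.powCdf_nonneg r₁) hD (H₁.tendsto_powCdf_div hr₁)

lemma tendsto_prodBER_div (hr₁ : r₁ ≠ 0) (hr₂ : r₂ ≠ 0) (hC : 0 < C) (hp : 0 < p) (hq : 0 < q)
    (h : H₂.order r₂ < H₁.order r₁) :
    Tendsto (fun s => prodBER H₁ H₂ r₁ r₂ C p q s / s ^ H₂.order r₂) (nhdsWithin 0 (Ioi 0))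
      (nhds (H₂.coeff * (C ^ H₂.order r₂ * H₁.negMoment (r₁ * H₂.order r₂))
        * (Real.Gamma (p + H₂.order r₂) * q ^ (-H₂.order r₂)))) := by
  obtain ⟨D, hD0, hD⟩ := exists_prodCdf_le_of_order_lt H₁ H₂ hr₁ hr₂ hC h
  exact tendsto_integral_gammaWeight_div hp hq (H₂.order_pos hr₂) (measurable_prodCdf H₁ H₂ hC)
    (prodCdf_nonneg H₁ H₂ _ _ _) hD (tendsto_prodCdf_div H₁ H₂ hr₁ hr₂ hC h)

end TwoHops

end UWOC

end

/-! ### Asymptotic comparison in the three regimes of the orders. -/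

noncomputable section

namespace UWOC

section General

variable {ι : Type*} {l : Filter ι} {u v : ι → ℝ}

lemma isLittleO_sub_of_tendsto_div {g : ℝ → ℝ} {a κ : ℝ}
    (hg : Tendsto (fun s => g s / s ^ a) (nhdsWithin 0 (Ioi 0)) (nhds κ))
    (hu : Tendsto u l atTop) :
    (fun i => g (u i)⁻¹ - κ * u i ^ (-a)) =o[l] fun i => u i ^ (-a) := by
  have h0 : ∀ᶠ i in l, 0 < u i := hu.eventually_gt_atTop 0
  rw [isLittleO_iff_tendsto' (h0.mono fun i hi h =>
    absurd h (Real.rpow_pos_of_pos hi _).ne')]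
  have h1 := (hg.comp (tendsto_inv_atTop_nhdsGT_zero.comp hu)).sub_const κ
  rw [sub_self] at h1
  refine h1.congr' ?_
  filter_upwards [h0] with i hi
  have h2 : (u i)⁻¹ ^ a = u i ^ (-a) := by rw [Real.inv_rpow hi.le, Real.rpow_neg hi.le]
  have h3 := (Real.rpow_pos_of_pos hi (-a)).ne'
  simp only [Function.comp_apply]
  rw [h2, sub_div, mul_div_cancel_right₀ _ h3]

lemma isLittleO_rpow_neg {a e : ℝ} (h : a < e) (hu : Tendsto u l atTop) :
    (fun i => u i ^ (-e)) =o[l] fun i => u i ^ (-a) := by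
  have h0 : ∀ᶠ i in l, 0 < u i := hu.eventually_gt_atTop 0
  rw [isLittleO_iff_tendsto' (h0.mono fun i hi h =>
    absurd h (Real.rpow_pos_of_pos hi _).ne')]
  refine ((tendsto_rpow_neg_atTop (sub_pos.mpr h)).comp hu).congr' ?_
  filter_upwards [h0] with i hi
  rw [Function.comp_apply, ← Real.rpow_sub hi]
  ring_nf

lemma isBigO_rpow_neg {a e : ℝ} (h : a ≤ e) (hu : Tendsto u l atTop) :
    (fun i => u i ^ (-e)) =O[l] fun i => u i ^ (-a) := by
  rcases h.eq_or_lt with rfl | h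
  · exact isBigO_refl _ _
  · exact (isLittleO_rpow_neg h hu).isBigO

lemma isLittleO_mul_rpow_neg {a e : ℝ} (he : 0 < e) (h : a ≤ e) (hu : Tendsto u l atTop)
    (hv : Tendsto v l atTop) :
    (fun i => (u i * v i) ^ (-e)) =o[l] fun i => u i ^ (-a) := by
  have h1 := (isBigO_rpow_neg h hu).mul_isLittleO (isLittleO_rpow_neg he hv)
  refine h1.congr' ?_ ?_
  · filter_upwards [hu.eventually_gt_atTop 0, hv.eventually_gt_atTop 0] with i hi hi'
    rw [Real.mul_rpow hi.le hi'.le]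
  · exact Eventually.of_forall fun i => by simp

/-- The factor `0 ^ z` matches those in `EGG.coeff`: for `e = a` the difference vanishes
identically, for `e > a` the subtracted term does. -/
lemma isLittleO_rpow_neg_sub {a e z A : ℝ} (f : ℝ → ℝ) {r : ℕ} (hr : r ≠ 0)
    (hz : z = r * (e - a)) (h : a ≤ e) (hu : Tendsto u l atTop) :
    (fun i => A * f e * u i ^ (-e) - A * 0 ^ z * f a * u i ^ (-a)) =o[l]
      fun i => u i ^ (-a) := by
  rcases h.eq_or_lt with rfl | h
  · rw [hz, sub_self, mul_zero, Real.rpow_zero]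
    simp
  · have hz0 : z ≠ 0 := by
      rw [hz]
      exact mul_ne_zero (by positivity) (sub_pos.mpr h).ne'
    rw [Real.zero_rpow hz0]
    simpa using (isLittleO_rpow_neg h hu).const_mul_left (A * f e)

/-- Nonnegativity of the common main terms rules out cancellation in the sum over `k`, so the errors
stay negligible against the total. -/
lemma isEquivalent_sum {κ : Type*} [Fintype κ] [Nonempty κ] {J J' V : κ → ι → ℝ} {S : ι → ℝ}
    (hJ : ∀ k, (fun i => J k i - V k i) =o[l] S) (hJ' : ∀ k, (fun i => J' k i - V k i) =o[l] S)
    (hV : ∀ k, S =O[l] V k) (hV0 : ∀ k, ∀ᶠ i in l, 0 ≤ V k i) :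
    (fun i => ∑ k, J k i) ~[l] fun i => ∑ k, J' k i := by
  have hS : S =O[l] fun i => ∑ k, V k i := by
    obtain ⟨k₀⟩ := ‹Nonempty κ›
    refine (hV k₀).trans (IsBigO.of_bound 1 ?_)
    filter_upwards [eventually_all.mpr hV0] with i hi
    rw [one_mul, Real.norm_of_nonneg (hi k₀),
      Real.norm_of_nonneg (Finset.sum_nonneg fun k _ => hi k)]
    exact Finset.single_le_sum (f := fun k => V k i) (fun k _ => hi k) (Finset.mem_univ k₀)
  have key : ∀ {K : κ → ι → ℝ}, (∀ k, (fun i => K k i - V k i) =o[l] S) →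
      (fun i => ∑ k, K k i) ~[l] fun i => ∑ k, V k i := fun {K} hK => by
    have h := (IsLittleO.fun_sum (s := Finset.univ) fun k _ => hK k).trans_isBigO hS
    refine h.congr_left fun i => ?_
    simp [Finset.sum_sub_distrib]
  exact (key hJ).trans (key hJ').symm

end General

section TwoHops

variable (H₁ H₂ : EGG) {r₁ r₂ : ℕ} {C p q : ℝ} {l : Filter (ℝ × ℝ)}

/-- The coefficient of `μ ^ (-H.order r)` in the summand of the average BER of a single hop. -/
def EGG.berCoeff (H : EGG) (r : ℕ) (p q : ℝ) : ℝ :=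
  H.coeff * (Real.Gamma (p + H.order r) * q ^ (-H.order r))

lemma EGG.berCoeff_pos {r : ℕ} (hr : r ≠ 0) (hp : 0 < p) (hq : 0 < q) :
    0 < H₁.berCoeff r p q := by
  have := H₁.coeff_pos
  have := Real.Gamma_pos_of_pos (add_pos hp (H₁.order_pos hr))
  unfold EGG.berCoeff
  positivity

lemma isLittleO_berSummand_sub [IsProbabilityMeasure H₁.law] [IsProbabilityMeasure H₂.law]
    (hr₁ : r₁ ≠ 0) (hC : 0 < C) (hp : 0 < p) (hq : 0 < q)
    (hl₁ : Tendsto Prod.fst l atTop) (hl₂ : Tendsto Prod.snd l atTop) :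
    (fun μ : ℝ × ℝ => berSummand H₁ H₂ r₁ r₂ C p q μ.1 μ.2
      - (H₁.berCoeff r₁ p q * μ.1 ^ (-H₁.order r₁)
        + prodBER H₁ H₂ r₁ r₂ C p q (μ.1 * μ.2)⁻¹)) =o[l]
      fun μ => μ.1 ^ (-H₁.order r₁) := by
  obtain ⟨D, hD0, hD⟩ := exists_abs_berSummand_sub_le H₁ H₂ (r₂ := r₂) hr₁ hC hp hq
  have hT := (tendsto_truncMoment H₂ r₂ (H₁.order_pos hr₁) hC).comp hl₂
  have h1 : (fun μ : ℝ × ℝ => berSummand H₁ H₂ r₁ r₂ C p q μ.1 μ.2 - hopBER H₁ r₁ p q μ.1⁻¹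
        - prodBER H₁ H₂ r₁ r₂ C p q (μ.1 * μ.2)⁻¹) =o[l] fun μ => μ.1 ^ (-H₁.order r₁) := by
    have h2 : (fun μ : ℝ × ℝ => D * μ.1 ^ (-H₁.order r₁)
        * truncMoment H₂ r₂ C (H₁.order r₁) μ.2) =o[l] fun μ => μ.1 ^ (-H₁.order r₁) := by
      have h3 := ((isBigO_refl (fun μ : ℝ × ℝ => μ.1 ^ (-H₁.order r₁)) l).const_mul_left
        D).mul_isLittleO ((isLittleO_one_iff ℝ).mpr hT)
      simpa using h3
    refine IsBigO.trans_isLittleO (IsBigO.of_bound 1 ?_) h2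
    filter_upwards [hl₁.eventually_gt_atTop 0, hl₂.eventually_gt_atTop 0] with μ h1 h2
    have := hD μ.1 μ.2 h1 h2
    rw [Real.inv_rpow h1.le, ← Real.rpow_neg h1.le] at this
    rw [one_mul, Real.norm_eq_abs]
    exact this.trans (le_abs_self _)
  have h4 := isLittleO_sub_of_tendsto_div (tendsto_hopBER_div H₁ hr₁ hp hq) hl₁
  refine (h1.add h4).congr_left fun μ => ?_
  rw [EGG.berCoeff]
  ring

lemma isLittleO_prodBER_of_lt [IsProbabilityMeasure H₁.law] [IsProbabilityMeasure H₂.law]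
    (hr₁ : r₁ ≠ 0) (hr₂ : r₂ ≠ 0) (hC : 0 < C) (hp : 0 < p)
    (hq : 0 < q) (hl₁ : Tendsto Prod.fst l atTop) (hl₂ : Tendsto Prod.snd l atTop)
    (h : H₁.order r₁ < H₂.order r₂) :
    (fun μ : ℝ × ℝ => prodBER H₁ H₂ r₁ r₂ C p q (μ.1 * μ.2)⁻¹) =o[l]
      fun μ => μ.1 ^ (-H₁.order r₁) := by
  obtain ⟨D, hD0, hD⟩ := exists_prodBER_le H₁ H₂ hr₁ hr₂ hC hp hq
  refine IsBigO.trans_isLittleO (IsBigO.of_bound (D / (H₂.order r₂ - H₁.order r₁)) ?_)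
    (isLittleO_mul_rpow_neg (H₁.order_pos hr₁) le_rfl hl₁ hl₂)
  filter_upwards [hl₁.eventually_gt_atTop 0, hl₂.eventually_gt_atTop 0] with μ h1 h2
  have h12 : 0 < μ.1 * μ.2 := by positivity
  have := hD _ (μ.1 * μ.2)⁻¹ (H₁.order_pos hr₁).le le_rfl h (by positivity)
  rw [Real.inv_rpow h12.le, ← Real.rpow_neg h12.le] at this
  rw [Real.norm_of_nonneg (prodBER_nonneg _ _ _ _ _ _ hq _), Real.norm_of_nonneg (by positivity)]
  exact this

lemma isLittleO_prodBER_of_eq [IsProbabilityMeasure H₁.law] [IsProbabilityMeasure H₂.law]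
    (hr₁ : r₁ ≠ 0) (hr₂ : r₂ ≠ 0) (hC : 0 < C) (hp : 0 < p)
    (hq : 0 < q) (hl₁ : Tendsto Prod.fst l atTop) (hl₂ : Tendsto Prod.snd l atTop)
    (h : H₁.order r₁ = H₂.order r₂)
    (hlog : (fun μ : ℝ × ℝ => Real.log μ.1) =o[l] fun μ => μ.2 ^ H₁.order r₁) :
    (fun μ : ℝ × ℝ => prodBER H₁ H₂ r₁ r₂ C p q (μ.1 * μ.2)⁻¹) =o[l]
      fun μ => μ.1 ^ (-H₁.order r₁) := by
  obtain ⟨D, hD0, hD⟩ := exists_prodBER_le H₁ H₂ hr₁ hr₂ hC hp hq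
  have hα := H₁.order_pos hr₁
  rw [← h] at hD
  set α := H₁.order r₁
  have hlog2 : (fun μ : ℝ × ℝ => Real.log μ.2) =o[l] fun μ => μ.2 ^ α :=
    (isLittleO_log_rpow_atTop hα).comp_tendsto hl₂
  have hs : (fun μ : ℝ × ℝ => μ.1 ^ (-α) * μ.2 ^ (-α) * (Real.log μ.1 + Real.log μ.2)) =o[l]
      fun μ => μ.1 ^ (-α) := by
    refine ((isBigO_refl (fun μ : ℝ × ℝ => μ.1 ^ (-α) * μ.2 ^ (-α)) l).mul_isLittleO
      (hlog.add hlog2)).congr' EventuallyEq.rfl ?_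
    filter_upwards [hl₂.eventually_gt_atTop 0] with μ h2
    rw [mul_assoc, ← Real.rpow_add h2, neg_add_cancel, Real.rpow_zero, mul_one]
  refine IsBigO.trans_isLittleO (IsBigO.of_bound (D * Real.exp 1) ?_) hs
  -- Eventually `L = log (μ₁ μ₂)` is at least `1 / α`, so that the exponent `α - 1 / L` chosen below
  -- is nonnegative.
  have hlog1 : Tendsto (fun μ : ℝ × ℝ => Real.log μ.1) l atTop := Real.tendsto_log_atTop.comp hl₁
  filter_upwards [hl₁.eventually_gt_atTop 0, hl₂.eventually_ge_atTop 1,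
    hlog1.eventually_ge_atTop (1 / α)] with μ h1 h2 h3
  have h2' : 0 < μ.2 := one_pos.trans_le h2
  have h12 : 0 < μ.1 * μ.2 := by positivity
  set L := Real.log μ.1 + Real.log μ.2 with hL
  have hL' : Real.log (μ.1 * μ.2) = L := Real.log_mul h1.ne' h2'.ne'
  have hLα : 1 / α ≤ L := by linarith [Real.log_nonneg h2]
  have hL0 : 0 < L := (by positivity : 0 < 1 / α).trans_le hLα
  have hLi : 1 / L ≤ α := by
    rw [div_le_iff₀ hα] at hLα
    rw [div_le_iff₀ hL0]
    linarith
  -- With `s = e ^ (-L)`, this exponent gives `s ^ (α - 1 / L) = e * s ^ α`, while the blow-up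
  -- factor is only `L`: a logarithmic loss.
  have := hD (α - 1 / L) (μ.1 * μ.2)⁻¹ (by linarith) (sub_le_self _ (by positivity))
    (sub_lt_self _ (by positivity)) (by positivity)
  have e : (μ.1 * μ.2)⁻¹ ^ (α - 1 / L) = Real.exp 1 * (μ.1 ^ (-α) * μ.2 ^ (-α)) := by
    rw [Real.inv_rpow h12.le, ← Real.rpow_neg h12.le, neg_sub, sub_eq_add_neg,
      Real.rpow_add h12, ← Real.mul_rpow h1.le h2'.le]
    congr 1
    rw [Real.rpow_def_of_pos h12, hL', mul_one_div_cancel hL0.ne']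
  rw [e, sub_sub_cancel, div_div_eq_mul_div, div_one] at this
  rw [Real.norm_of_nonneg (prodBER_nonneg _ _ _ _ _ _ hq _), Real.norm_of_nonneg (by positivity)]
  calc _ ≤ _ := this
    _ = _ := by ring

lemma isLittleO_prodBER_sub_of_lt [IsProbabilityMeasure H₁.law] [IsProbabilityMeasure H₂.law]
    (hr₁ : r₁ ≠ 0) (hr₂ : r₂ ≠ 0) (hC : 0 < C) (hp : 0 < p)
    (hq : 0 < q) (hl₁ : Tendsto Prod.fst l atTop) (hl₂ : Tendsto Prod.snd l atTop)
    (h : H₂.order r₂ < H₁.order r₁) :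
    (fun μ : ℝ × ℝ => prodBER H₁ H₂ r₁ r₂ C p q (μ.1 * μ.2)⁻¹
      - H₂.coeff * (C ^ H₂.order r₂ * H₁.negMoment (r₁ * H₂.order r₂))
        * (Real.Gamma (p + H₂.order r₂) * q ^ (-H₂.order r₂)) * (μ.1 * μ.2) ^ (-H₂.order r₂))
      =o[l] fun μ => (μ.1 * μ.2) ^ (-H₂.order r₂) :=
  isLittleO_sub_of_tendsto_div (tendsto_prodBER_div H₁ H₂ hr₁ hr₂ hC hp hq h)
    (hl₁.atTop_mul_atTop₀ hl₂)

/-- The coefficient of `(μ₁ μ₂) ^ (-1 / r₂)` in `highSNRSummand`. -/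
def highSNRCoeff₃ (H₁ H₂ : EGG) (r₁ r₂ : ℕ) (C p q : ℝ) : ℝ :=
  H₂.w * (1 - H₁.w) / Real.Gamma H₁.a * Real.Gamma (H₁.a - r₁ / (H₁.c * r₂))
      * (Real.Gamma (p + 1 / r₂) * (C / (H₁.b ^ r₁ * H₂.lam ^ r₂) / q) ^ (1 / r₂ : ℝ))

/-- The coefficient of `(μ₁ μ₂) ^ (-a₂ c₂ / r₂)` in `highSNRSummand`. -/
def highSNRCoeff₄ (H₁ H₂ : EGG) (r₁ r₂ : ℕ) (C p q : ℝ) : ℝ :=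
  (1 - H₂.w) / Real.Gamma (H₂.a + 1) * H₁.negMoment (r₁ * H₂.a * H₂.c / r₂)
      * (Real.Gamma (p + H₂.a * H₂.c / r₂) * (C / H₂.b ^ r₂ / q) ^ (H₂.a * H₂.c / r₂))

lemma div_mul_div_rpow {A B x e : ℝ} (hA : 0 < A) (hB : 0 < B) (hx : 0 < x) (hq : 0 < q) :
    (A / (B * x) / q) ^ e = (A / B / q) ^ e * x ^ (-e) := by
  rw [show A / (B * x) / q = A / B / q * x⁻¹ by rw [div_mul_eq_div_div]; ring,
    Real.mul_rpow (by positivity) (by positivity), Real.inv_rpow hx.le, Real.rpow_neg hx.le]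

lemma highSNRSummand_eq (hr₁ : r₁ ≠ 0) (hC : 0 < C)
    (hq : 0 < q) {μ₁ μ₂ : ℝ} (hμ₁ : 0 < μ₁) (hμ₂ : 0 < μ₂) :
    highSNRSummand H₁ H₂ r₁ r₂ C p q μ₁ μ₂
      = H₁.w / H₁.lam * (Real.Gamma (p + 1 / r₁) * q ^ (-(1 / r₁) : ℝ)) * μ₁ ^ (-(1 / r₁) : ℝ)
        + (1 - H₁.w) / (H₁.b ^ (H₁.a * H₁.c) * Real.Gamma (H₁.a + 1))
          * (Real.Gamma (p + H₁.a * H₁.c / r₁) * q ^ (-(H₁.a * H₁.c / r₁)))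
          * μ₁ ^ (-(H₁.a * H₁.c / r₁))
        + highSNRCoeff₃ H₁ H₂ r₁ r₂ C p q * (μ₁ * μ₂) ^ (-(1 / r₂) : ℝ)
        + highSNRCoeff₄ H₁ H₂ r₁ r₂ C p q * (μ₁ * μ₂) ^ (-(H₂.a * H₂.c / r₂)) := by
  have hl₁ := H₁.lam_pos; have hb₁ := H₁.b_pos
  have hl₂ := H₂.lam_pos; have hb₂ := H₂.b_pos
  have hr : (r₁ : ℝ) ≠ 0 := by positivity
  have hμ : 0 < μ₁ * μ₂ := by positivity
  have e' : ∀ {B e : ℝ}, 0 < B → (1 / B ^ r₁ / q) ^ (e / r₁) = q ^ (-(e / r₁)) / B ^ e := by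
    intro B e hB
    rw [Real.div_rpow (by positivity) hq.le, Real.div_rpow zero_le_one (by positivity),
      Real.one_rpow, ← Real.rpow_natCast, ← Real.rpow_mul hB.le, mul_div_cancel₀ _ hr,
      Real.rpow_neg hq.le]
    field_simp
  rw [highSNRSummand, div_mul_div_rpow one_pos (by positivity) hμ₁ hq,
    div_mul_div_rpow one_pos (by positivity) hμ₁ hq, mul_assoc (H₁.b ^ r₁ * H₂.lam ^ r₂) μ₁ μ₂,
    mul_assoc (H₂.b ^ r₂) μ₁ μ₂,
    div_mul_div_rpow (B := H₁.b ^ r₁ * H₂.lam ^ r₂) hC (by positivity) hμ hq,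
    div_mul_div_rpow (B := H₂.b ^ r₂) hC (by positivity) hμ hq,
    e' hl₁, e' hb₁, Real.rpow_one, highSNRCoeff₃,
    highSNRCoeff₄, EGG.negMoment, div_div _ (r₂ : ℝ) H₁.c, mul_comm (r₂ : ℝ) H₁.c]
  ring

lemma isLittleO_highSNRSummand_sub (hr₁ : r₁ ≠ 0) (hC : 0 < C)
    (hq : 0 < q) (hl₁ : Tendsto Prod.fst l atTop) (hl₂ : Tendsto Prod.snd l atTop) :
    (fun μ : ℝ × ℝ => highSNRSummand H₁ H₂ r₁ r₂ C p q μ.1 μ.2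
      - (H₁.berCoeff r₁ p q * μ.1 ^ (-H₁.order r₁)
        + highSNRCoeff₃ H₁ H₂ r₁ r₂ C p q * (μ.1 * μ.2) ^ (-(1 / r₂) : ℝ)
        + highSNRCoeff₄ H₁ H₂ r₁ r₂ C p q * (μ.1 * μ.2) ^ (-(H₂.a * H₂.c / r₂)))) =o[l]
      fun μ => μ.1 ^ (-H₁.order r₁) := by
  have hr : (r₁ : ℝ) ≠ 0 := by positivity
  have h1 := isLittleO_rpow_neg_sub (A := H₁.w / H₁.lam) (z := 1 - H₁.expo) (a := H₁.order r₁)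
    (e := 1 / r₁) (fun e => Real.Gamma (p + e) * q ^ (-e)) hr₁
    (by rw [H₁.order_eq]; field_simp)
    (by rw [H₁.order_eq]; gcongr; exact H₁.expo_le_one) hl₁
  have h2 := isLittleO_rpow_neg_sub (z := H₁.a * H₁.c - H₁.expo) (a := H₁.order r₁)
    (A := (1 - H₁.w) / (H₁.b ^ (H₁.a * H₁.c) * Real.Gamma (H₁.a + 1)))
    (e := H₁.a * H₁.c / r₁) (fun e => Real.Gamma (p + e) * q ^ (-e)) hr₁
    (by rw [H₁.order_eq]; field_simp)
    (by rw [H₁.order_eq]; gcongr; exact H₁.expo_le_mul) hl₁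
  refine (h1.add h2).congr' ?_ EventuallyEq.rfl
  filter_upwards [hl₁.eventually_gt_atTop 0, hl₂.eventually_gt_atTop 0] with μ hμ₁ hμ₂
  rw [highSNRSummand_eq H₁ H₂ hr₁ hC hq hμ₁ hμ₂, EGG.berCoeff, EGG.coeff]
  ring

/-- For `a₂ c₂ < 1` the generalized Gamma component alone determines the order of hop 2, so the
fourth coefficient is the true limit constant of `prodBER`. -/
lemma highSNRCoeff₄_eq (hr₂ : r₂ ≠ 0) (hC : 0 < C) (hq : 0 < q) (h : H₂.a * H₂.c < 1) :
    highSNRCoeff₄ H₁ H₂ r₁ r₂ C p q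
      = H₂.coeff * (C ^ H₂.order r₂ * H₁.negMoment (r₁ * H₂.order r₂))
        * (Real.Gamma (p + H₂.order r₂) * q ^ (-H₂.order r₂)) := by
  have hb := H₂.b_pos
  have hr : (r₂ : ℝ) ≠ 0 := by positivity
  have he : H₂.expo = H₂.a * H₂.c := min_eq_right h.le
  have ho : H₂.order r₂ = H₂.a * H₂.c / r₂ := by rw [H₂.order_eq, he]
  have h1 : (C / H₂.b ^ r₂ / q) ^ (H₂.a * H₂.c / r₂) = C ^ (H₂.a * H₂.c / r₂)
      / H₂.b ^ (H₂.a * H₂.c) * q ^ (-(H₂.a * H₂.c / r₂)) := by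
    rw [Real.div_rpow (by positivity) hq.le, Real.div_rpow hC.le (by positivity),
      ← Real.rpow_natCast, ← Real.rpow_mul hb.le, mul_div_cancel₀ _ hr, Real.rpow_neg hq.le]
    field_simp
  have h2 : (r₁ : ℝ) * H₂.a * H₂.c / r₂ = r₁ * (H₂.a * H₂.c / r₂) := by ring
  rw [highSNRCoeff₄, EGG.coeff, he, ho, h1, h2, sub_self, Real.rpow_zero,
    Real.zero_rpow (sub_pos.mpr h).ne']
  have := (Real.Gamma_pos_of_pos (add_pos H₂.a_pos one_pos)).ne'
  field_simp
  ring

/-- The regime in which the first hop determines the average BER. -/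
lemma isLittleO_sub_of_prodBER [IsProbabilityMeasure H₁.law] [IsProbabilityMeasure H₂.law]
    (hr₁ : r₁ ≠ 0) (hC : 0 < C) (hp : 0 < p) (hq : 0 < q)
    (hl₁ : Tendsto Prod.fst l atTop) (hl₂ : Tendsto Prod.snd l atTop)
    (hQ : (fun μ : ℝ × ℝ => prodBER H₁ H₂ r₁ r₂ C p q (μ.1 * μ.2)⁻¹) =o[l]
      fun μ => μ.1 ^ (-H₁.order r₁))
    (h₃ : (fun μ : ℝ × ℝ => (μ.1 * μ.2) ^ (-(1 / r₂) : ℝ)) =o[l] fun μ => μ.1 ^ (-H₁.order r₁))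
    (h₄ : (fun μ : ℝ × ℝ => (μ.1 * μ.2) ^ (-(H₂.a * H₂.c / r₂))) =o[l]
      fun μ => μ.1 ^ (-H₁.order r₁)) :
    (fun μ : ℝ × ℝ => berSummand H₁ H₂ r₁ r₂ C p q μ.1 μ.2
      - H₁.berCoeff r₁ p q * μ.1 ^ (-H₁.order r₁)) =o[l] (fun μ => μ.1 ^ (-H₁.order r₁)) ∧
    (fun μ : ℝ × ℝ => highSNRSummand H₁ H₂ r₁ r₂ C p q μ.1 μ.2
      - H₁.berCoeff r₁ p q * μ.1 ^ (-H₁.order r₁)) =o[l] (fun μ => μ.1 ^ (-H₁.order r₁)) := by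
  constructor
  · refine ((isLittleO_berSummand_sub H₁ H₂ (r₂ := r₂) hr₁ hC hp hq hl₁ hl₂).add
      hQ).congr_left fun μ => ?_
    ring
  · refine ((isLittleO_highSNRSummand_sub H₁ H₂ (r₂ := r₂) (p := p) hr₁ hC hq hl₁ hl₂).add
      ((h₃.const_mul_left (highSNRCoeff₃ H₁ H₂ r₁ r₂ C p q)).add
        (h₄.const_mul_left (highSNRCoeff₄ H₁ H₂ r₁ r₂ C p q)))).congr_left fun μ => ?_
    ring

lemma sum_berSummand_isEquivalent_of_prodBER [IsProbabilityMeasure H₁.law]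
    [IsProbabilityMeasure H₂.law] {κ : Type*} [Fintype κ] [Nonempty κ] {q : κ → ℝ}
    (hr₁ : r₁ ≠ 0) (hC : 0 < C) (hp : 0 < p) (hq : ∀ k, 0 < q k)
    (hl₁ : Tendsto Prod.fst l atTop) (hl₂ : Tendsto Prod.snd l atTop)
    (hQ : ∀ k, (fun μ : ℝ × ℝ => prodBER H₁ H₂ r₁ r₂ C p (q k) (μ.1 * μ.2)⁻¹) =o[l]
      fun μ => μ.1 ^ (-H₁.order r₁))
    (h₃ : (fun μ : ℝ × ℝ => (μ.1 * μ.2) ^ (-(1 / r₂) : ℝ)) =o[l] fun μ => μ.1 ^ (-H₁.order r₁))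
    (h₄ : (fun μ : ℝ × ℝ => (μ.1 * μ.2) ^ (-(H₂.a * H₂.c / r₂))) =o[l]
      fun μ => μ.1 ^ (-H₁.order r₁)) :
    (fun μ : ℝ × ℝ => ∑ k, berSummand H₁ H₂ r₁ r₂ C p (q k) μ.1 μ.2) ~[l]
      fun μ => ∑ k, highSNRSummand H₁ H₂ r₁ r₂ C p (q k) μ.1 μ.2 := by
  have h := fun k => isLittleO_sub_of_prodBER H₁ H₂ hr₁ hC hp (hq k) hl₁ hl₂ (hQ k) h₃ h₄
  refine isEquivalent_sum (fun k => (h k).1) (fun k => (h k).2) (fun k => ?_) (fun k => ?_)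
  · exact isBigO_self_const_mul (H₁.berCoeff_pos hr₁ hp (hq k)).ne' _ _
  · filter_upwards [hl₁.eventually_gt_atTop 0] with μ h1
    have := H₁.berCoeff_pos hr₁ hp (hq k)
    positivity

/-- The regime in which the generalized Gamma component of the second hop matters. -/
lemma sum_berSummand_isEquivalent_of_lt [IsProbabilityMeasure H₁.law]
    [IsProbabilityMeasure H₂.law] {κ : Type*} [Fintype κ] [Nonempty κ] {q : κ → ℝ}
    (hr₁ : r₁ ≠ 0) (hr₂ : r₂ ≠ 0) (hC : 0 < C) (hp : 0 < p) (hq : ∀ k, 0 < q k)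
    (hl₁ : Tendsto Prod.fst l atTop) (hl₂ : Tendsto Prod.snd l atTop)
    (h : H₂.order r₂ < H₁.order r₁) (hac : H₂.a * H₂.c < 1) :
    (fun μ : ℝ × ℝ => ∑ k, berSummand H₁ H₂ r₁ r₂ C p (q k) μ.1 μ.2) ~[l]
      fun μ => ∑ k, highSNRSummand H₁ H₂ r₁ r₂ C p (q k) μ.1 μ.2 := by
  have he : H₂.expo = H₂.a * H₂.c := min_eq_right hac.le
  have ho : H₂.order r₂ = H₂.a * H₂.c / r₂ := by rw [H₂.order_eq, he]
  set K : κ → ℝ := fun k => H₂.coeff * (C ^ H₂.order r₂ * H₁.negMoment (r₁ * H₂.order r₂))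
        * (Real.Gamma (p + H₂.order r₂) * q k ^ (-H₂.order r₂)) with hK
  have hK0 : ∀ k, 0 < K k := fun k => by
    have := hq k
    have := H₂.coeff_pos
    have := H₁.negMoment_pos (H₁.mul_lt_expo hr₁ h)
    have := Real.Gamma_pos_of_pos (add_pos hp (H₂.order_pos hr₂))
    simp only [hK]
    positivity
  -- Along a general filter neither scale need dominate the other; errors are measured against the
  -- sum of both.
  set S : ℝ × ℝ → ℝ := fun μ => μ.1 ^ (-H₁.order r₁) + (μ.1 * μ.2) ^ (-H₂.order r₂) with hS
  have hpos : ∀ᶠ μ : ℝ × ℝ in l, 0 < μ.1 ∧ 0 < μ.2 :=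
    (hl₁.eventually_gt_atTop 0).and (hl₂.eventually_gt_atTop 0)
  have hS₁ : (fun μ : ℝ × ℝ => μ.1 ^ (-H₁.order r₁)) =O[l] S := by
    refine IsBigO.of_bound 1 ?_
    filter_upwards [hpos] with μ ⟨h1, h2⟩
    rw [one_mul, Real.norm_of_nonneg (by positivity), Real.norm_of_nonneg (by positivity)]
    exact le_add_of_nonneg_right (by positivity)
  have hS₂ : (fun μ : ℝ × ℝ => (μ.1 * μ.2) ^ (-H₂.order r₂)) =O[l] S := by
    refine IsBigO.of_bound 1 ?_
    filter_upwards [hpos] with μ ⟨h1, h2⟩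
    rw [one_mul, Real.norm_of_nonneg (by positivity), Real.norm_of_nonneg (by positivity)]
    exact le_add_of_nonneg_left (by positivity)
  refine isEquivalent_sum (S := S) (V := fun k μ => H₁.berCoeff r₁ p (q k) * μ.1 ^ (-H₁.order r₁)
    + K k * (μ.1 * μ.2) ^ (-H₂.order r₂)) (fun k => ?_) (fun k => ?_) (fun k => ?_) (fun k => ?_)
  · have h1 := (isLittleO_berSummand_sub H₁ H₂ (r₂ := r₂) hr₁ hC hp (hq k) hl₁
      hl₂).trans_isBigO hS₁
    have h2 := (isLittleO_prodBER_sub_of_lt H₁ H₂ hr₁ hr₂ hC hp (hq k) hl₁ hl₂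
      h).trans_isBigO hS₂
    refine (h1.add h2).congr_left fun μ => ?_
    simp only [hK]
    ring
  · have h1 := (isLittleO_highSNRSummand_sub H₁ H₂ (r₂ := r₂) (p := p) hr₁ hC (hq k) hl₁
      hl₂).trans_isBigO hS₁
    have hlt : H₂.order r₂ < 1 / r₂ := by
      rw [ho]
      have : (0 : ℝ) < r₂ := by positivity
      gcongr
    have h2 := ((isLittleO_rpow_neg hlt (hl₁.atTop_mul_atTop₀ hl₂)).trans_isBigO
      hS₂).const_mul_left (highSNRCoeff₃ H₁ H₂ r₁ r₂ C p (q k))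
    refine (h1.add h2).congr_left fun μ => ?_
    rw [highSNRCoeff₄_eq H₁ H₂ hr₂ hC (hq k) hac, ho]
    simp only [hK, ho]
    ring
  · have hm : 0 < min (H₁.berCoeff r₁ p (q k)) (K k) :=
      lt_min (H₁.berCoeff_pos hr₁ hp (hq k)) (hK0 k)
    refine IsBigO.of_bound (min (H₁.berCoeff r₁ p (q k)) (K k))⁻¹ ?_
    filter_upwards [hpos] with μ ⟨h1, h2⟩
    have := H₁.berCoeff_pos hr₁ hp (hq k)
    have := hK0 k
    rw [Real.norm_of_nonneg (by positivity), Real.norm_of_nonneg (by positivity),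
      inv_mul_eq_div, le_div_iff₀ hm, hS, add_mul, mul_comm (μ.1 ^ _), mul_comm ((μ.1 * μ.2) ^ _)]
    gcongr
    · exact min_le_left _ _
    · exact min_le_right _ _
  · filter_upwards [hpos] with μ ⟨h1, h2⟩
    have := H₁.berCoeff_pos hr₁ hp (hq k)
    have := hK0 k
    positivity

lemma sum_berSummand_isEquivalent [IsProbabilityMeasure H₁.law]
    [IsProbabilityMeasure H₂.law] {κ : Type*} [Fintype κ] [Nonempty κ] {q : κ → ℝ}
    (hr₁ : r₁ ≠ 0) (hr₂ : r₂ ≠ 0) (hC : 0 < C) (hp : 0 < p) (hq : ∀ k, 0 < q k)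
    (hl₁ : Tendsto Prod.fst l atTop) (hl₂ : Tendsto Prod.snd l atTop)
    (hlog : H₁.order r₁ = H₂.order r₂ →
      (fun μ : ℝ × ℝ => Real.log μ.1) =o[l] fun μ => μ.2 ^ H₁.order r₁)
    (hexp : 1 ≤ H₂.a * H₂.c → 1 / r₂ < H₁.order r₁ →
      (fun μ : ℝ × ℝ => (μ.1 * μ.2) ^ (-(1 / r₂) : ℝ)) =o[l] fun μ => μ.1 ^ (-H₁.order r₁)) :
    (fun μ : ℝ × ℝ => ∑ k, berSummand H₁ H₂ r₁ r₂ C p (q k) μ.1 μ.2) ~[l]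
      fun μ => ∑ k, highSNRSummand H₁ H₂ r₁ r₂ C p (q k) μ.1 μ.2 := by
  have hr : (0 : ℝ) < r₂ := by positivity
  have hac := mul_pos H₂.a_pos H₂.c_pos
  have hβ₁ : H₂.order r₂ ≤ 1 / r₂ := by
    rw [H₂.order_eq]; gcongr; exact H₂.expo_le_one
  have hβ₂ : H₂.order r₂ ≤ H₂.a * H₂.c / r₂ := by
    rw [H₂.order_eq]; gcongr; exact H₂.expo_le_mul
  rcases lt_or_ge (H₂.order r₂) (H₁.order r₁) with h | h
  · rcases lt_or_ge (H₂.a * H₂.c) 1 with h1 | h1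
    · exact sum_berSummand_isEquivalent_of_lt H₁ H₂ hr₁ hr₂ hC hp hq hl₁ hl₂ h h1
    · have ho : H₂.order r₂ = 1 / r₂ := by
        rw [H₂.order_eq, EGG.expo, min_eq_left h1]
      have h₃ := hexp h1 (ho ▸ h)
      have hmul : Tendsto (fun μ : ℝ × ℝ => μ.1 * μ.2) l atTop := hl₁.atTop_mul_atTop₀ hl₂
      refine sum_berSummand_isEquivalent_of_prodBER H₁ H₂ hr₁ hC hp hq hl₁ hl₂ (fun k => ?_) h₃
        ((isBigO_rpow_neg (by gcongr) hmul).trans_isLittleO h₃)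
      have h2 := isLittleO_prodBER_sub_of_lt H₁ H₂ hr₁ hr₂ hC hp (hq k) hl₁ hl₂ h
      rw [ho] at h2
      refine ((h2.isBigO.add (isBigO_const_mul_self _ _ l)).congr_left
        fun μ => sub_add_cancel _ _).trans_isLittleO h₃
  · refine sum_berSummand_isEquivalent_of_prodBER H₁ H₂ hr₁ hC hp hq hl₁ hl₂ (fun k => ?_)
      (isLittleO_mul_rpow_neg (by positivity) (h.trans hβ₁) hl₁ hl₂)
      (isLittleO_mul_rpow_neg (by positivity) (h.trans hβ₂) hl₁ hl₂)
    rcases h.eq_or_lt with h | h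
    · exact isLittleO_prodBER_of_eq H₁ H₂ hr₁ hr₂ hC hp (hq k) hl₁ hl₂ h (hlog h)
    · exact isLittleO_prodBER_of_lt H₁ H₂ hr₁ hr₂ hC hp (hq k) hl₁ hl₂ h

end TwoHops

end UWOC

end

/-! ### Assembly of the main theorem. -/

noncomputable section

namespace UWOC

lemma endSNR_nonneg (r₁ r₂ : ℕ) {C μ₁ μ₂ x y : ℝ} (hC : 0 < C) (hμ₁ : 0 < μ₁) (hμ₂ : 0 < μ₂)
    (hx : 0 < x) (hy : 0 < y) : 0 ≤ endSNR r₁ r₂ C μ₁ μ₂ x y := by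
  unfold endSNR hopSNR
  positivity

end UWOC

end

theorem mainTheorem7
    {Ω : Type*} [MeasurableSpace Ω] (P : Measure Ω) [IsProbabilityMeasure P]
    (H₁ H₂ : UWOC.EGG) (I₁ I₂ : Ω → ℝ)
    (hI₁ : HasLaw I₁ H₁.law P) (hI₂ : HasLaw I₂ H₂.law P) (hI : IndepFun I₁ I₂ P)
    (r₁ r₂ : ℕ) (hr₁ : r₁ = 1 ∨ r₁ = 2) (hr₂ : r₂ = 1 ∨ r₂ = 2)
    (C : ℝ) (hC : 0 < C) (M : UWOC.Modulation) :
    -- the average BER in terms of the distribution function of the end-to-end SNR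
    (∀ μ₁ μ₂ : ℝ, 0 < μ₁ → 0 < μ₂ →
      M.avgBER P (fun o => UWOC.endSNR r₁ r₂ C μ₁ μ₂ (I₁ o) (I₂ o))
        = M.berOfCDF (UWOC.cdfOf P fun o => UWOC.endSNR r₁ r₂ C μ₁ μ₂ (I₁ o) (I₂ o))) ∧
    -- the high-SNR distribution function substituted there
    (∀ μ₁ μ₂ : ℝ, 0 < μ₁ → 0 < μ₂ →
      (∀ k, IntegrableOn (fun x => x ^ (M.p - 1) * Real.exp (-(M.q k * x))
        * UWOC.cdfHighSNR H₁ H₂ r₁ r₂ C μ₁ μ₂ x) (Ioi 0)) ∧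
      M.berOfCDF (UWOC.cdfHighSNR H₁ H₂ r₁ r₂ C μ₁ μ₂)
        = M.berHighSNR H₁ H₂ r₁ r₂ C μ₁ μ₂) ∧
    -- the average BER is asymptotic to the resulting sum as both average electrical SNRs grow
    (∀ l : Filter (ℝ × ℝ), Tendsto Prod.fst l atTop → Tendsto Prod.snd l atTop →
      (H₁.order r₁ = H₂.order r₂ →
        (fun μ : ℝ × ℝ => Real.log μ.1) =o[l] fun μ => μ.2 ^ H₁.order r₁) →
      (1 ≤ H₂.a * H₂.c → 1 / r₂ < H₁.order r₁ →
        (fun μ : ℝ × ℝ => (μ.1 * μ.2) ^ (-(1 / r₂) : ℝ)) =o[l]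
          fun μ => μ.1 ^ (-H₁.order r₁)) →
      (fun μ : ℝ × ℝ =>
          M.avgBER P fun o => UWOC.endSNR r₁ r₂ C μ.1 μ.2 (I₁ o) (I₂ o))
        ~[l] fun μ => M.berHighSNR H₁ H₂ r₁ r₂ C μ.1 μ.2) := by
  have hr₁' : r₁ ≠ 0 := by omega
  have hr₂' : r₂ ≠ 0 := by omega
  -- The total mass of the EGG density is not computed: it is `1` because the law is that of a
  -- random variable on a probability space.
  have : IsProbabilityMeasure H₁.law := hI₁.isProbabilityMeasure_iff.mp inferInstance
  have : IsProbabilityMeasure H₂.law := hI₂.isProbabilityMeasure_iff.mp inferInstance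
  have hpart : ∀ μ₁ μ₂ : ℝ, 0 < μ₁ → 0 < μ₂ →
      M.avgBER P (fun o => UWOC.endSNR r₁ r₂ C μ₁ μ₂ (I₁ o) (I₂ o))
        = M.berOfCDF (UWOC.cdfOf P fun o => UWOC.endSNR r₁ r₂ C μ₁ μ₂ (I₁ o) (I₂ o)) := by
    intro μ₁ μ₂ hμ₁ hμ₂
    refine M.avgBER_eq_berOfCDF P ((UWOC.measurable_endSNR μ₁ μ₂).comp_aemeasurable
      (hI₁.aemeasurable.prodMk hI₂.aemeasurable)) ?_
    filter_upwards [(hI₁.ae_iff measurableSet_Ioi.mem).mpr H₁.law_ae_pos,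
      (hI₂.ae_iff measurableSet_Ioi.mem).mpr H₂.law_ae_pos] with o h1 h2
    exact UWOC.endSNR_nonneg r₁ r₂ hC hμ₁ hμ₂ h1 h2
  refine ⟨hpart, fun μ₁ μ₂ hμ₁ hμ₂ => ⟨fun k => (UWOC.integral_cdfHighSNR H₁ H₂ hr₁' hr₂' hC hμ₁
    hμ₂ M.p_pos (M.q_pos k)).1, M.berOfCDF_cdfHighSNR H₁ H₂ hr₁' hr₂' hC hμ₁ hμ₂⟩,
    fun l hl₁ hl₂ hlog hexp => ?_⟩
  have : Nonempty (Fin M.n) := ⟨⟨0, M.n_pos⟩⟩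
  have h := (IsEquivalent.refl (u := fun _ : ℝ × ℝ => M.δ / (2 * Real.Gamma M.p))).mul
    (UWOC.sum_berSummand_isEquivalent H₁ H₂ hr₁' hr₂' hC M.p_pos M.q_pos hl₁ hl₂ hlog hexp)
  refine (h.congr_left ?_).congr_right ?_
  · filter_upwards [hl₁.eventually_gt_atTop 0, hl₂.eventually_gt_atTop 0] with μ hμ₁ hμ₂
    rw [hpart μ.1 μ.2 hμ₁ hμ₂, UWOC.Modulation.berOfCDF]
    simp only [UWOC.cdfOf_endSNR H₁ H₂ P hI₁ hI₂ hI hC hμ₁ hμ₂]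
    rfl
  · exact Eventually.of_forall fun μ => (M.berHighSNR_eq H₁ H₂ μ.1 μ.2).symm
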